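/- Let $\mathbb{X}$ be a finite-dimensional Euclidean space (in particular $\mathbb{R}^{n\times m}$ or the symmetric matrices $\mathbb{S}^n$, with the trace inner product). Let $\mathcal{F}:\mathbb{X}\to\mathbb{R}^d$ and $\mathcal{A}:\mathbb{X}\to\mathbb{R}^e$ be linear, $C\in\mathbb{X}$, $b\in\mathbb{R}^e$, let $\mathcal{Q}\subseteq\mathbb{R}^e$ be a convex polyhedral cone with dual cone $\mathcal{Q}^*$, let $\theta:\mathbb{X}\to(-\infty,+\infty]$ be proper closed convex, and let $h:\mathbb{R}^d\to(-\infty,+\infty]$ be closed convex and continuously differentiable on $\operatorname{dom}h$, which is nonempty and open. Consider the primal problem $$\min_{X\in\mathbb{X}}\ \Phi(X):=h(\mathcal{F}X)+\langle C,X\rangle+\theta(X)\quad\text{s.t. } \mathcal{A}X\in b+\mathcal{Q},$$ with feasible set $F_P$ and set of optimal solutions $\Omega_P$ (finite optimal value), and its dual over $Z=(y,w,S)\in\mathbb{R}^e\times\mathbb{R}^d\times\mathbb{X}$, $$\min_{Z}\ \Psi(Z):=\delta_{\mathcal{Q}^*}(y)-\langle b,y\rangle+h^*(-w)+\theta^*(-S)\quad\text{s.t.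 } R(Z):=\mathcal{A}^*y+\mathcal{F}^*w+S-C=0,$$ with optimal value $\Psi^*\in(-\infty,+\infty]$. Here $\delta_{\mathcal{Q}^*}$ is the indicator function of $\mathcal{Q}^*$, and $h^*,\theta^*$ are the conjugate functions. For $c>0$ put $L_c(Z,X)=\Psi(Z)+\langle X,R(Z)\rangle+\frac c2\|R(Z)\|^2$. Assume $\Omega_P\neq\emptyset$, let $0<c_k\uparrow c_\infty\le\infty$ be nondecreasing, and let $\{(Z^k,X^k)\}$ be an infinite sequence generated by the augmented Lagrangian method: with $\zeta_k(Z):=L_{c_k}(Z,X^k)$ and $X^{k+1}=X^k+c_kR(Z^{k+1})$, the point $Z^{k+1}$ satisfies, for all $k\ge0$, $$(A')\qquad \zeta_k(Z^{k+1})-\inf\zeta_k\le\varepsilon_k^2/(2c_k),\qquad \varepsilon_k\ge0,\ \sum_k\varepsilon_k<\infty.$$ Then $\{X^k\}$ is bounded and converges to some $X^\infty\in\Omega_P$, and for all $k\ge 0$ $$\|R(Z^{k+1})\|=c_k^{-1}\|X^{k+1}-X^k\|\to0,$$ $$\Psi(Z^{k+1})-\Psi^*\le\zeta_k(Z^{k+1})-\inf\zeta_k+\tfrac{1}{2c_k}\big(\|X^k\|^2-\|X^{k+1}\|^2\big).$$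 Moreover, if the dual problem has a nonempty bounded solution set, then $\{Z^k\}$ is bounded and all of its accumulation points are optimal solutions of the dual problem. Suppose in addition that quadratic growth holds at $X^\infty$ with modulus $\kappa_p>0$, i.e. for some $\delta_p>0$, $\Phi(X)\ge\Phi(X^\infty)+\kappa_p\operatorname{dist}^2(X,\Omega_P)$ for all $X\in F_P$ with $\|X-X^\infty\|\le\delta_p$, and that also $$(B')\qquad \zeta_k(Z^{k+1})-\inf\zeta_k\le\frac{\eta_k^2}{2c_k}\|X^{k+1}-X^k\|^2,\qquad \eta_k\ge0,\ \sum_k\eta_k<\infty .$$ Then there is $\bar k$ such that for all $k\ge\bar k$ one has $\eta_k<1$ and $$\operatorname{dist}(X^{k+1},\Omega_P)\le\theta_k\operatorname{dist}(X^k,\Omega_P),$$ $$\|R(Z^{k+1})\|\le\tau_k^1\operatorname{dist}(X^k,\Omega_P),\qquad \Psi(Z^{k+1})-\Psi^*\le\tau_k^2\operatorname{dist}(X^k,\Omega_P),$$ where, with $\mu_k=1/\sqrt{1+c_k^2\kappa_p^2}$, $$\theta_k=\frac{\mu_k+2\eta_k}{1-\eta_k}\to\theta_\infty=\frac1{\sqrt{1+c_\infty^2\kappa_p^2}}<1,\qquad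 \tau_k^1=\frac{1}{c_k(1-\eta_k)}\to\frac1{c_\infty},$$ $$\tau_k^2=\tfrac12\tau_k^1\big(\eta_k^2\|X^{k+1}-X^k\|+\|X^{k+1}\|+\|X^k\|\big)\to\frac{\|X^\infty\|}{c_\infty}$$ (all three limits being $0$ if $c_\infty=\infty$). Thus $\operatorname{dist}(X^k,\Omega_P)$ converges Q-(super)linearly to $0$, and the dual infeasibility and the dual objective gap are bounded above by R-(super)linearly vanishing quantities. -/

import Mathlib

open Filter Topology
open scoped ENNReal RealInnerProductSpace

noncomputable section

namespace MatrixOpt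

/-! ### Extended-real-valued convex functions -/

section ConvexAnalysis

variable {E : Type*} [NormedAddCommGroup E] [InnerProductSpace ℝ E]

/-- Effective domain of an extended-real-valued function. -/
def edom (f : E → EReal) : Set E := {x | f x ≠ ⊤}

/-- Convexity of an extended-real-valued function: its epigraph is convex. -/
def EConvex (f : E → EReal) : Prop :=
  Convex ℝ {p : E × ℝ | f p.1 ≤ (p.2 : EReal)}

/-- Proper: never `-∞`, and finite somewhere. -/
def EProper (f : E → EReal) : Prop :=
  (∀ x, f x ≠ ⊥) ∧ (edom f).Nonempty

/-- Proper closed (lower semicontinuous) convex functions `E → (-∞, +∞]`. -/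
def ProperClosedConvex (f : E → EReal) : Prop :=
  EProper f ∧ LowerSemicontinuous f ∧ EConvex f

/-- The conjugate function `f*(y) = sup_x (⟨y, x⟩ - f x)`. -/
def conj (f : E → EReal) (y : E) : EReal :=
  ⨆ x, ((⟪y, x⟫ : ℝ) : EReal) - f x

/-- The indicator function of a set: `0` on the set, `+∞` off it. -/
def indic (D : Set E) (x : E) : EReal :=
  open Classical in if x ∈ D then 0 else ⊤

/-- The dual cone `Q* = {y | ⟨y, q⟩ ≥ 0 for all q ∈ Q}`. -/
def dualCone (Q : Set E) : Set E := {y | ∀ q ∈ Q, 0 ≤ ⟪y, q⟫}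

/-- A convex polyhedral cone: a finite intersection of closed half-spaces through the origin. -/
def IsPolyhedralCone (Q : Set E) : Prop :=
  ∃ s : Finset E, Q = {q | ∀ a ∈ s, 0 ≤ ⟪a, q⟫}

end ConvexAnalysis

/-! ### The primal and the dual problem -/

/-- The Euclidean space `ℝⁿ`. -/
abbrev Vec (n : ℕ) : Type := EuclideanSpace ℝ (Fin n)

/-- The space of the dual variables `Z = (y, w, S)`. -/
abbrev DualVar (d e : ℕ) (𝕏 : Type*) : Type _ := Vec e × Vec d × 𝕏

/-- The data of the problem `min h(F X) + ⟨C, X⟩ + θ(X)` subject to `A X ∈ b + Q`. The decision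
space `𝕏` is a finite-dimensional Euclidean space, such as the rectangular or the symmetric
matrices with the trace inner product. -/
structure Problem (d e : ℕ) (𝕏 : Type*) [NormedAddCommGroup 𝕏] [InnerProductSpace ℝ 𝕏] where
  /-- the smooth part of the objective -/
  h : Vec d → EReal
  /-- the nonsmooth part of the objective -/
  θ : 𝕏 → EReal
  /-- the linear operator inside `h` -/
  F : 𝕏 →ₗ[ℝ] Vec d
  /-- the linear operator of the constraint -/
  A : 𝕏 →ₗ[ℝ] Vec e
  /-- the linear cost -/
  C : 𝕏
  /-- the right-hand side of the constraint -/
  b : Vec e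
  /-- the cone of the constraint -/
  Q : Set (Vec e)

variable {d e : ℕ} {𝕏 : Type*} [NormedAddCommGroup 𝕏] [InnerProductSpace ℝ 𝕏]

namespace Problem

/-- The standing assumptions on the data: `h` is a closed convex function `ℝᵈ → (-∞, +∞]` whose
domain is nonempty and open and on which it is continuously differentiable (convexity of the
domain follows), `θ` is proper closed convex, and `Q` is a convex polyhedral cone. -/
structure Standing (P : Problem d e 𝕏) : Prop where
  h_convex : ProperClosedConvex P.h
  h_open : IsOpen (edom P.h)
  h_smooth : ContDiffOn ℝ 1 (fun u => (P.h u).toReal) (edom P.h)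
  θ_convex : ProperClosedConvex P.θ
  Q_polyhedral : IsPolyhedralCone P.Q

/-- The primal objective `Φ`. -/
def Φ (P : Problem d e 𝕏) (X : 𝕏) : EReal :=
  P.h (P.F X) + ((⟪P.C, X⟫ : ℝ) : EReal) + P.θ X

/-- The primal feasible set. -/
def FP (P : Problem d e 𝕏) : Set 𝕏 := {X | P.A X - P.b ∈ P.Q}

/-- The primal optimal solution set (feasible points with the least objective value, which has to
be finite). -/
def ΩP (P : Problem d e 𝕏) : Set 𝕏 :=
  {X | X ∈ P.FP ∧ P.Φ X ≠ ⊤ ∧ ∀ Y ∈ P.FP, P.Φ X ≤ P.Φ Y}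

/-- The quadratic growth condition for the primal problem at `Xbar` with modulus `κ`. -/
def QuadGrowth (P : Problem d e 𝕏) (Xbar : 𝕏) (κ : ℝ) : Prop :=
  ∃ δ > 0, ∀ X ∈ P.FP ∩ Metric.closedBall Xbar δ,
    P.Φ Xbar + ((κ * Metric.infDist X P.ΩP ^ 2 : ℝ) : EReal) ≤ P.Φ X

/-- The dual objective `Ψ(y, w, S) = δ_{Q*}(y) - ⟨b, y⟩ + h*(-w) + θ*(-S)`. -/
def Ψ (P : Problem d e 𝕏) (Z : DualVar d e 𝕏) : EReal :=
  indic (dualCone P.Q) Z.1 + ((-⟪P.b, Z.1⟫ : ℝ) : EReal) + conj P.h (-Z.2.1) + conj P.θ (-Z.2.2)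

variable [FiniteDimensional ℝ 𝕏]

/-- The dual residual `A* y + F* w + S - C`. -/
def res (P : Problem d e 𝕏) (Z : DualVar d e 𝕏) : 𝕏 :=
  LinearMap.adjoint P.A Z.1 + LinearMap.adjoint P.F Z.2.1 + Z.2.2 - P.C

/-- The dual feasible set. -/
def FD (P : Problem d e 𝕏) : Set (DualVar d e 𝕏) :=
  {Z | P.res Z = 0 ∧ Z.1 ∈ dualCone P.Q}

/-- The optimal value of the dual problem. -/
def Ψopt (P : Problem d e 𝕏) : EReal := ⨅ Z ∈ P.FD, P.Ψ Z

/-- The dual optimal solution set (with finite optimal value). -/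
def ΩD (P : Problem d e 𝕏) : Set (DualVar d e 𝕏) :=
  {Z | Z ∈ P.FD ∧ P.Ψ Z ≠ ⊤ ∧ ∀ Z' ∈ P.FD, P.Ψ Z ≤ P.Ψ Z'}

/-- The Lagrangian of the dual problem. -/
def lag (P : Problem d e 𝕏) (Z : DualVar d e 𝕏) (X : 𝕏) : EReal :=
  P.Ψ Z + ((⟪X, P.res Z⟫ : ℝ) : EReal)

/-- The augmented Lagrangian of the dual problem with penalty parameter `c`. -/
def augLag (P : Problem d e 𝕏) (c : ℝ) (Z : DualVar d e 𝕏) (X : 𝕏) : EReal :=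
  P.lag Z X + ((c / 2 * ‖P.res Z‖ ^ 2 : ℝ) : EReal)

/-- `ζ_k(Z⁺) - inf ζ_k`, the inexactness of `Z⁺` as a minimizer of
`ζ_k = augLag c (·) X`. -/
def subGap (P : Problem d e 𝕏) (c : ℝ) (X : 𝕏) (Zp : DualVar d e 𝕏) : EReal :=
  P.augLag c Zp X - ⨅ Z, P.augLag c Z X

/-- `(Z, X)` is an infinite sequence generated by the augmented Lagrangian method with penalty
parameters `c`, the subproblems being solved up to the stopping criterion (A') with tolerances
`ε`. (`Z 0` plays no role in the method.) -/
structure IsALM (P : Problem d e 𝕏) (c ε : ℕ → ℝ) (Z : ℕ → DualVar d e 𝕏) (X : ℕ → 𝕏) :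
    Prop where
  ε_nonneg : ∀ k, 0 ≤ ε k
  ε_summable : Summable ε
  approx : ∀ k, P.subGap (c k) (X k) (Z (k + 1)) ≤ ((ε k ^ 2 / (2 * c k) : ℝ) : EReal)
  update : ∀ k, X (k + 1) = X k + c k • P.res (Z (k + 1))

/-- The additional stopping criterion (B') with tolerances `η`. -/
structure CriterionB (P : Problem d e 𝕏) (c η : ℕ → ℝ) (Z : ℕ → DualVar d e 𝕏) (X : ℕ → 𝕏) :
    Prop where
  η_nonneg : ∀ k, 0 ≤ η k
  η_summable : Summable η
  approx : ∀ k, P.subGap (c k) (X k) (Z (k + 1)) ≤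
    ((η k ^ 2 / (2 * c k) * ‖X (k + 1) - X k‖ ^ 2 : ℝ) : EReal)

end Problem

/-! ### The rates -/

/-- `μ_k = 1 / √(1 + c_k² κ²)`. -/
def rateμ (κ : ℝ) (c : ℕ → ℝ) (k : ℕ) : ℝ := 1 / √(1 + c k ^ 2 * κ ^ 2)

/-- `θ_k = (μ_k + 2 η_k) (1 - η_k)⁻¹`. -/
def rateθ (κ : ℝ) (c η : ℕ → ℝ) (k : ℕ) : ℝ := (rateμ κ c k + 2 * η k) * (1 - η k)⁻¹

/-- `θ_∞ = 1 / √(1 + c_∞² κ²)`, with value `0` if `c_∞ = ∞`. -/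
def rateθInf (κ : ℝ) (cInf : ℝ≥0∞) : ℝ :=
  open Classical in if cInf = ⊤ then 0 else 1 / √(1 + cInf.toReal ^ 2 * κ ^ 2)

/-- `τ_k¹ = c_k⁻¹ (1 - η_k)⁻¹`. -/
def rateτ₁ (c η : ℕ → ℝ) (k : ℕ) : ℝ := (c k)⁻¹ * (1 - η k)⁻¹

/-- `τ_k² = τ_k¹ (η_k² ‖X^{k+1} - X^k‖ + ‖X^{k+1}‖ + ‖X^k‖) / 2`. -/
def rateτ₂ (c η : ℕ → ℝ) (X : ℕ → 𝕏) (k : ℕ) : ℝ :=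
  rateτ₁ c η k * (η k ^ 2 * ‖X (k + 1) - X k‖ + ‖X (k + 1)‖ + ‖X k‖) / 2

/-- `1 / c_∞`, with value `0` if `c_∞ = ∞`. -/
def invInf (cInf : ℝ≥0∞) : ℝ :=
  open Classical in if cInf = ⊤ then 0 else 1 / cInf.toReal

end MatrixOpt

end

noncomputable section

namespace MatrixOpt

/-! ### Epigraphs of extended-real-valued functions -/

section Epigraph

/-! The augmented Lagrangian method on the dual is an inexact proximal point method on the primal
function `primal`, which is `Φ` plus the indicator of the feasible set. Let `p` be the proximal
point of `primal` at `X` with parameter `c`, and `γ` the value of `primal` there.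

Strong duality for the subproblem (`Standing.iInf_augLag`) says that the infimum of the augmented
Lagrangian is minus the Moreau envelope, `-γ - ‖p - X‖² / (2c)`. No constraint qualification enters:
separating in the space of pairs (residual, dual value) only shows that the right pair lies in a
closure, which is enough for an infimum. Weak duality at `p` and completion of a square
(`norm_sq_step`) show that every `Z` exceeds this infimum by at least `‖X + c R(Z) - p‖² / (2c)`.
Hence (A') puts the new multiplier within `ε` of the exact proximal point, and (B') within `η` times
the step length (`Standing.norm_sub_prox_sq_le`).

Convergence is then the Fejér argument for summable errors (`exists_tendsto_of_isProx`). Since the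
augmented Lagrangian agrees with `Ψ` at feasible points, its infimum is at most the dual value,
whence the bound on the objective gap (`Standing.Ψ_sub_Ψopt_le`). Bounded dual iterates come from
compactness: an escaping subsequence, pulled back along segments to a sphere around a solution,
would produce a solution on that sphere.

For the rates, quadratic growth at `p` and the subgradient inequality give `c κ dist(p) ≤ ‖p - X‖`;
obtuseness of the angle at `p` gives `dist(p)² + ‖p - X‖² ≤ dist(X)²`. Together they yield the
factor `μ` (`IsProx.infDist_le`), and `step_rates` adds the error of (B'). -/

/-- The epigraph, as a subset of `V × ℝ`. -/
def epi {V : Type*} (f : V → EReal) : Set (V × ℝ) := {p | f p.1 ≤ (p.2 : EReal)}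

theorem mem_epi {V : Type*} {f : V → EReal} {p : V × ℝ} : p ∈ epi f ↔ f p.1 ≤ (p.2 : EReal) :=
  Iff.rfl

theorem exists_coe_of_le {a : EReal} {t : ℝ} (ha : a ≠ ⊥) (h : a ≤ (t : EReal)) :
    ∃ r : ℝ, a = r ∧ r ≤ t := by
  lift a to ℝ using ⟨fun h' => by simp [h'] at h, ha⟩
  exact ⟨a, rfl, by exact_mod_cast h⟩

theorem exists_coe_add_of_le {a b : EReal} {t : ℝ} (ha : a ≠ ⊥) (hb : b ≠ ⊥)
    (h : a + b ≤ (t : EReal)) : ∃ r s : ℝ, a = r ∧ b = s ∧ r + s ≤ t := by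
  have ha' : a ≠ ⊤ := by
    rintro rfl
    rw [EReal.top_add_of_ne_bot hb] at h
    simp at h
  have hb' : b ≠ ⊤ := by
    rintro rfl
    rw [EReal.add_top_of_ne_bot ha] at h
    simp at h
  lift a to ℝ using ⟨ha', ha⟩
  lift b to ℝ using ⟨hb', hb⟩
  exact ⟨a, b, rfl, rfl, by exact_mod_cast h⟩

variable {V W : Type*} [AddCommGroup V] [Module ℝ V] [AddCommGroup W] [Module ℝ W]

theorem convex_epi_add {f g : V → EReal} (hf : Convex ℝ (epi f)) (hg : Convex ℝ (epi g))
    (hf' : ∀ x, f x ≠ ⊥) (hg' : ∀ x, g x ≠ ⊥) : Convex ℝ (epi fun x => f x + g x) := by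
  rintro ⟨x, s⟩ hx ⟨y, t⟩ hy a b ha hb hab
  obtain ⟨s₁, s₂, h₁, h₂, hs⟩ := exists_coe_add_of_le (hf' x) (hg' x) hx
  obtain ⟨t₁, t₂, h₃, h₄, ht⟩ := exists_coe_add_of_le (hf' y) (hg' y) hy
  have hF := @hf (x, s₁) h₁.le (y, t₁) h₃.le a b ha hb hab
  have hG := @hg (x, s₂) h₂.le (y, t₂) h₄.le a b ha hb hab
  have := add_le_add (mem_epi.1 hF) (mem_epi.1 hG)
  refine mem_epi.2 (this.trans ?_)
  simp only [Prod.snd_add, Prod.smul_snd, smul_eq_mul]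
  norm_cast
  nlinarith

theorem convex_epi_comp {f : W → EReal} (hf : Convex ℝ (epi f)) (L : V →ₗ[ℝ] W) :
    Convex ℝ (epi fun x => f (L x)) :=
  hf.linear_preimage (L.prodMap LinearMap.id)

theorem convex_epi_linear (ℓ : V →ₗ[ℝ] ℝ) : Convex ℝ (epi fun x => ((ℓ x : ℝ) : EReal)) := by
  rintro ⟨x, s⟩ hx ⟨y, t⟩ hy a b ha hb hab
  have hx : ℓ x ≤ s := EReal.coe_le_coe_iff.1 hx
  have hy : ℓ y ≤ t := EReal.coe_le_coe_iff.1 hy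
  simp only [mem_epi, Prod.smul_mk, Prod.mk_add_mk, map_add, map_smul, smul_eq_mul]
  norm_cast
  nlinarith [mul_le_mul_of_nonneg_left hx ha, mul_le_mul_of_nonneg_left hy hb]

end Epigraph

section Indicator

variable {E : Type*} {D : Set E} {x : E}

theorem indic_of_mem (h : x ∈ D) : indic D x = 0 := by simp [indic, h]

theorem indic_of_notMem (h : x ∉ D) : indic D x = ⊤ := by simp [indic, h]

theorem indic_ne_bot : indic D x ≠ ⊥ := by
  by_cases h : x ∈ D
  · simp [indic_of_mem h]
  · simp [indic_of_notMem h]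

theorem indic_le_coe {t : ℝ} : indic D x ≤ (t : EReal) ↔ x ∈ D ∧ 0 ≤ t := by
  by_cases h : x ∈ D
  · simp [indic_of_mem h, h]
  · simp [indic_of_notMem h, h]

theorem convex_epi_indic [AddCommGroup E] [Module ℝ E] (hD : Convex ℝ D) : Convex ℝ (epi (indic D)) := by
  have : epi (indic D) = D ×ˢ Set.Ici (0 : ℝ) := by
    ext p
    simp [mem_epi, indic_le_coe]
  rw [this]
  exact hD.prod (convex_Ici 0)

theorem lowerSemicontinuous_indic [TopologicalSpace E] (hD : IsClosed D) : LowerSemicontinuous (indic D) := by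
  rw [lowerSemicontinuous_iff_isClosed_preimage]
  intro t
  by_cases ht : 0 ≤ t
  · by_cases ht' : t = ⊤
    · simp [ht']
    · have : indic D ⁻¹' Set.Iic t = D := by
        ext x
        by_cases h : x ∈ D <;> simp [indic_of_mem, indic_of_notMem, h, ht, ht']
      rwa [this]
  · have : indic D ⁻¹' Set.Iic t = ∅ := by
      ext x
      by_cases h : x ∈ D
      · simpa [indic_of_mem h] using not_le.1 ht
      · simp only [Set.mem_preimage, indic_of_notMem h, Set.mem_Iic, top_le_iff,
          Set.mem_empty_iff_false, iff_false]
        rintro rfl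
        exact ht le_top
    rw [this]
    exact isClosed_empty

end Indicator

theorem lowerSemicontinuous_ereal_add {V : Type*} [TopologicalSpace V] {f g : V → EReal}
    (hf : LowerSemicontinuous f) (hg : LowerSemicontinuous g)
    (hf' : ∀ x, f x ≠ ⊥) (hg' : ∀ x, g x ≠ ⊥) : LowerSemicontinuous fun x => f x + g x :=
  hf.add' hg fun x => EReal.continuousAt_add (Or.inr (hg' x)) (Or.inl (hf' x))

theorem isClosed_epi {V : Type*} [TopologicalSpace V] {f : V → EReal}
    (hf : LowerSemicontinuous f) : IsClosed (epi f) :=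
  hf.isClosed_epigraph.preimage
    (continuous_fst.prodMk (continuous_coe_real_ereal.comp continuous_snd))

/-! ### Conjugates and affine minorants -/

section Conjugate

variable {E : Type*} [NormedAddCommGroup E] [InnerProductSpace ℝ E] {f : E → EReal}

theorem conj_ne_bot (hf : (edom f).Nonempty) (y : E) : conj f y ≠ ⊥ := by
  obtain ⟨x, hx⟩ := hf
  refine ne_bot_of_le_ne_bot ?_ (le_iSup (fun x => ((⟪y, x⟫ : ℝ) : EReal) - f x) x)
  rw [sub_eq_add_neg, EReal.add_ne_bot_iff]
  exact ⟨EReal.coe_ne_bot _, by simpa [edom] using hx⟩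

/-- Quantifying over the epigraph instead of the domain replaces an extended-real supremum by
inequalities between reals. -/
theorem conj_le_coe {y : E} {t : ℝ} (hf : ∀ x, f x ≠ ⊥) :
    conj f y ≤ (t : EReal) ↔ ∀ p ∈ epi f, ⟪y, p.1⟫ - p.2 ≤ t := by
  rw [conj, iSup_le_iff]
  constructor
  · rintro h ⟨x, s⟩ hx
    obtain ⟨r, hr, hrs⟩ := exists_coe_of_le (hf x) hx
    have := h x
    rw [hr] at this
    have : ⟪y, x⟫ - r ≤ t := by exact_mod_cast this
    simp only
    linarith
  · intro h x
    by_cases hx : f x = ⊤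
    · simp [hx]
    · obtain ⟨r, hr⟩ : ∃ r : ℝ, f x = r := by
        lift f x to ℝ using ⟨hx, hf x⟩ with r
        exact ⟨r, rfl⟩
      have := h (x, r) hr.le
      rw [hr]
      exact_mod_cast this

theorem convex_epi_conj (hf : ∀ x, f x ≠ ⊥) : Convex ℝ (epi (conj f)) := by
  rintro ⟨y, s⟩ hy ⟨z, t⟩ hz a b ha hb hab
  rw [mem_epi, conj_le_coe hf] at hy hz
  rw [mem_epi]
  refine (conj_le_coe hf).2 fun p hp => ?_
  have h₁ := mul_le_mul_of_nonneg_left (hy p hp) ha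
  have h₂ := mul_le_mul_of_nonneg_left (hz p hp) hb
  simp only [Prod.smul_mk, Prod.mk_add_mk, inner_add_left, real_inner_smul_left, smul_eq_mul]
  have : p.2 = a * p.2 + b * p.2 := by rw [← add_mul, hab, one_mul]
  simp only at h₁ h₂
  linarith

theorem lowerSemicontinuous_conj (hf : ∀ x, f x ≠ ⊥) : LowerSemicontinuous (conj f) := by
  refine lowerSemicontinuous_iSup fun x => Continuous.lowerSemicontinuous ?_
  by_cases hx : f x = ⊤
  · simp only [hx, EReal.sub_top]
    exact continuous_const
  · lift f x to ℝ using ⟨hx, hf x⟩ with r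
    have : (fun y : E => ((⟪y, x⟫ : ℝ) : EReal) - (r : EReal)) =
        fun y => ((⟪y, x⟫ - r : ℝ) : EReal) := by
      ext y
      norm_cast
    rw [this]
    exact continuous_coe_real_ereal.comp (by fun_prop)

/-- Fenchel-Young. -/
theorem le_add_of_conj_le {x y : E} {r s : ℝ} (hf : ∀ x, f x ≠ ⊥) (hx : f x ≤ (r : EReal))
    (hy : conj f y ≤ (s : EReal)) : ⟪y, x⟫ ≤ r + s := by
  have := (conj_le_coe hf).1 hy (x, r) hx
  simp only at this
  linarith

variable [CompleteSpace E]

/-- Hahn-Banach in `E × ℝ`, with the functional written by Riesz as a pair `(y, s)` so that the sign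
of its vertical coefficient `s` can be discussed. -/
theorem exists_separation {K : Set (E × ℝ)} (hK : Convex ℝ K) (hK' : IsClosed K) {p : E × ℝ}
    (hp : p ∉ K) : ∃ (y : E) (s α : ℝ), ⟪y, p.1⟫ + s * p.2 < α ∧
      ∀ q ∈ K, α < ⟪y, q.1⟫ + s * q.2 := by
  obtain ⟨g, α, hg, hg'⟩ := geometric_hahn_banach_point_closed hK hK' hp
  have key : ∀ q : E × ℝ, g q =
      ⟪(InnerProductSpace.toDual ℝ E).symm (g.comp (ContinuousLinearMap.inl ℝ E ℝ)), q.1⟫ +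
        g (0, 1) * q.2 := by
    intro q
    rw [InnerProductSpace.toDual_symm_apply]
    have : q = (q.1, 0) + q.2 • ((0 : E), (1 : ℝ)) := by ext <;> simp
    conv_lhs => rw [this, map_add, map_smul]
    simp [mul_comm]
  refine ⟨(InnerProductSpace.toDual ℝ E).symm (g.comp (ContinuousLinearMap.inl ℝ E ℝ)),
    g (0, 1), α, ?_, fun q hq => ?_⟩
  · rw [← key]; exact hg
  · rw [← key]; exact hg' q hq

/-- A point outside a closed convex set that is upward closed and has an affine minorant is
strictly below some affine minorant. -/
theorem exists_affine_minorant {K : Set (E × ℝ)} (hK : Convex ℝ K) (hK' : IsClosed K)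
    (hup : ∀ u s t, (u, s) ∈ K → s ≤ t → (u, t) ∈ K)
    {y₀ : E} {β : ℝ} (hmin : ∀ q ∈ K, β ≤ q.2 + ⟪y₀, q.1⟫) {p : E × ℝ} (hp : p ∉ K) :
    ∃ (y : E) (a : ℝ), p.2 + ⟪y, p.1⟫ < a ∧ ∀ q ∈ K, a ≤ q.2 + ⟪y, q.1⟫ := by
  rcases K.eq_empty_or_nonempty with rfl | ⟨q₀, hq₀⟩
  · exact ⟨0, p.2 + 1, by simp, by simp⟩
  obtain ⟨y, s, α, hlt, hK₂⟩ := exists_separation hK hK' hp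
  -- If `s < 0`, climbing vertically inside `K` to height `τ` would violate the separation.
  have hs : 0 ≤ s := by
    by_contra! hs
    set τ := max q₀.2 ((α - ⟪y, q₀.1⟫) / s)
    have h₁ := hK₂ (q₀.1, τ) (hup _ q₀.2 _ hq₀ (le_max_left _ _))
    have h₂ : (α - ⟪y, q₀.1⟫) / s ≤ τ := le_max_right _ _
    rw [div_le_iff_of_neg hs] at h₂
    simp only at h₁
    linarith [mul_comm s τ]
  rcases hs.eq_or_lt with rfl | hs
  -- A vertical hyperplane is no minorant itself; adding a large multiple of it to the given
  -- minorant lifts that above `p` and keeps it below `K`.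
  · simp only [zero_mul, add_zero] at hlt hK₂
    have hδ : 0 < α - ⟪y, p.1⟫ := by linarith
    obtain ⟨n, hn⟩ := exists_nat_gt ((p.2 + ⟪y₀, p.1⟫ - β) / (α - ⟪y, p.1⟫))
    rw [div_lt_iff₀ hδ] at hn
    refine ⟨y₀ + (n : ℝ) • y, β + n * α, ?_, fun q hq => ?_⟩
    · simp only [inner_add_left, real_inner_smul_left]
      nlinarith
    · simp only [inner_add_left, real_inner_smul_left]
      have := mul_le_mul_of_nonneg_left (hK₂ q hq).le (Nat.cast_nonneg (α := ℝ) n)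
      linarith [hmin q hq]
  · refine ⟨s⁻¹ • y, s⁻¹ * α, ?_, fun q hq => ?_⟩
    · have := mul_lt_mul_of_pos_left hlt (inv_pos.2 hs)
      rw [mul_add, inv_mul_cancel_left₀ hs.ne'] at this
      rw [real_inner_smul_left]
      linarith
    · have := mul_lt_mul_of_pos_left (hK₂ q hq) (inv_pos.2 hs)
      rw [mul_add, inv_mul_cancel_left₀ hs.ne'] at this
      rw [real_inner_smul_left]
      linarith

/-- Separate the epigraph from a point directly below the graph: comparison with the graph point
above it forces a positive vertical coefficient. -/
theorem ProperClosedConvex.exists_minorant (hf : ProperClosedConvex f) :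
    ∃ (y : E) (β : ℝ), ∀ q ∈ epi f, β ≤ q.2 + ⟪y, q.1⟫ := by
  obtain ⟨⟨hbot, x, hx⟩, hlsc, hconv⟩ := hf
  obtain ⟨r, hr⟩ : ∃ r : ℝ, f x = r := by
    have hx : f x ≠ ⊤ := hx
    lift f x to ℝ using ⟨hx, hbot x⟩ with r
    exact ⟨r, rfl⟩
  have hnot : (x, r - 1) ∉ epi f := by
    rw [mem_epi, hr]
    simp only [EReal.coe_le_coe_iff]
    linarith
  obtain ⟨y, s, α, h₁, h₂⟩ := exists_separation hconv (isClosed_epi hlsc) hnot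
  have h₃ := h₂ (x, r) hr.le
  simp only at h₁ h₃
  have hs : 0 < s := by nlinarith
  refine ⟨s⁻¹ • y, s⁻¹ * α, fun q hq => ?_⟩
  have := mul_lt_mul_of_pos_left (h₂ q hq) (inv_pos.2 hs)
  rw [mul_add, inv_mul_cancel_left₀ hs.ne'] at this
  rw [real_inner_smul_left]
  linarith

/-- Fenchel-Moreau: a proper closed convex function is the supremum of the affine functions
given by its conjugate. -/
theorem ProperClosedConvex.exists_conj_le (hf : ProperClosedConvex f) {x : E} {r : ℝ}
    (hr : (r : EReal) < f x) : ∃ (y : E) (s : ℝ), conj f y ≤ (s : EReal) ∧ r < ⟪y, x⟫ - s := by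
  obtain ⟨y₀, β, hmin⟩ := hf.exists_minorant
  obtain ⟨y, a, h₁, h₂⟩ := exists_affine_minorant hf.2.2 (isClosed_epi hf.2.1)
    (fun u s t hs hst => le_trans (mem_epi.1 hs) (by exact_mod_cast hst)) hmin
    (p := (x, r)) (fun h => not_le.2 hr h)
  refine ⟨-y, -a, (conj_le_coe hf.1.1).2 fun p hp => ?_, ?_⟩
  · rw [inner_neg_left]; linarith [h₂ p hp]
  · rw [inner_neg_left]; simp only at h₁; linarith

theorem ProperClosedConvex.exists_conj_real (hf : ProperClosedConvex f) :
    ∃ (y : E) (s : ℝ), conj f y ≤ (s : EReal) := by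
  obtain ⟨y₀, β, hmin⟩ := hf.exists_minorant
  refine ⟨-y₀, -β, (conj_le_coe hf.1.1).2 fun p hp => ?_⟩
  rw [inner_neg_left]; linarith [hmin p hp]

end Conjugate

/-! ### Proximal steps -/

section Prox

variable {H : Type*} [NormedAddCommGroup H] [InnerProductSpace ℝ H] {G : H → EReal}

/-- `p` is the proximal point of `G` at `x` with parameter `c`, and `G p = γ`: the vector
`c⁻¹ (x - p)` is a subgradient of `G` at `p`. -/
def IsProx (G : H → EReal) (c : ℝ) (x p : H) (γ : ℝ) : Prop :=
  G p = γ ∧ ∀ y, ((γ + c⁻¹ * ⟪x - p, y - p⟫ : ℝ) : EReal) ≤ G y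

/-- `g` is the least value of `G`, and it is attained at `x`. -/
def IsMinVal (G : H → EReal) (g : ℝ) (x : H) : Prop :=
  G x = g ∧ ∀ y, (g : EReal) ≤ G y

/-- First-order condition: compare `p` with `p + t (y - p)`, use convexity, divide by `t` and let
`t` tend to `0`. -/
theorem isProx_of_forall_le (hbot : ∀ x, G x ≠ ⊥) (hconv : Convex ℝ (epi G)) {c : ℝ} (hc : 0 < c)
    {x p : H} {γ : ℝ} (hp : G p = γ)
    (hmin : ∀ y (s : ℝ), G y = s → γ + c⁻¹ / 2 * ‖p - x‖ ^ 2 ≤ s + c⁻¹ / 2 * ‖y - x‖ ^ 2) :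
    IsProx G c x p γ := by
  refine ⟨hp, fun y => ?_⟩
  by_cases hy : G y = ⊤
  · simp [hy]
  obtain ⟨s, hs⟩ : ∃ s : ℝ, G y = s := by
    lift G y to ℝ using ⟨hy, hbot y⟩ with s
    exact ⟨s, rfl⟩
  rw [hs, EReal.coe_le_coe_iff]
  have hc' : 0 < c⁻¹ := inv_pos.2 hc
  have step : ∀ t : ℝ, 0 < t → t ≤ 1 →
      γ + c⁻¹ * ⟪x - p, y - p⟫ ≤ s + t * (c⁻¹ / 2 * ‖y - p‖ ^ 2) := by
    intro t ht ht1
    have h₁ : ((1 - t) • p + t • y, (1 - t) * γ + t * s) ∈ epi G := by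
      have := @hconv (p, γ) hp.le (y, s) hs.le (1 - t) t (by linarith) ht.le (by ring)
      simpa using this
    obtain ⟨r, hr, hrs⟩ := exists_coe_of_le (hbot _) (mem_epi.1 h₁)
    have h₂ := hmin _ r hr
    have h₃ : (1 - t) • p + t • y - x = (p - x) + t • (y - p) := by module
    have h₄ : ⟪p - x, t • (y - p)⟫ = -(t * ⟪x - p, y - p⟫) := by
      rw [real_inner_smul_right, ← neg_sub x p, inner_neg_left]; ring
    simp only at h₂
    rw [h₃, norm_add_sq_real, h₄, norm_smul, mul_pow, Real.norm_eq_abs, sq_abs] at h₂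
    simp only at hrs
    have h₅ : t * (γ + c⁻¹ * ⟪x - p, y - p⟫) ≤ t * (s + t * (c⁻¹ / 2 * ‖y - p‖ ^ 2)) := by
      linarith
    exact le_of_mul_le_mul_left h₅ ht
  have hlim : Tendsto (fun t : ℝ => s + t * (c⁻¹ / 2 * ‖y - p‖ ^ 2)) (𝓝[>] 0) (𝓝 s) := by
    have : Tendsto (fun t : ℝ => s + t * (c⁻¹ / 2 * ‖y - p‖ ^ 2)) (𝓝 0)
        (𝓝 (s + 0 * (c⁻¹ / 2 * ‖y - p‖ ^ 2))) := by
      apply Continuous.tendsto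
      fun_prop
    simpa using this.mono_left nhdsWithin_le_nhds
  refine ge_of_tendsto hlim ?_
  filter_upwards [Ioc_mem_nhdsGT (zero_lt_one' ℝ)] with t ht using step t ht.1 ht.2

/-- Minimize over the ball around `x` through the minimizer `z`; outside it both `G` and the
quadratic term are at least their values at `z`, so the minimum is global. -/
theorem exists_isProx [FiniteDimensional ℝ H] (hG : ProperClosedConvex G) {g : ℝ} {z : H}
    (hz : IsMinVal G g z) {c : ℝ} (hc : 0 < c) (x : H) : ∃ p γ, IsProx G c x p γ := by
  obtain ⟨⟨hbot, -⟩, hlsc, hconv⟩ := hG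
  set q : H → ℝ := fun y => c⁻¹ / 2 * ‖y - x‖ ^ 2
  have hq : Continuous fun y => ((q y : ℝ) : EReal) :=
    continuous_coe_real_ereal.comp (by fun_prop)
  have hl := lowerSemicontinuous_ereal_add hlsc hq.lowerSemicontinuous hbot
    (fun _ => EReal.coe_ne_bot _)
  have hzK : z ∈ Metric.closedBall x ‖z - x‖ := by simp [dist_eq_norm]
  have : ProperSpace H := FiniteDimensional.proper ℝ H
  obtain ⟨p, hpK, hp⟩ := (hl.lowerSemicontinuousOn _).exists_isMinOn ⟨z, hzK⟩
    (isCompact_closedBall x ‖z - x‖)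
  have hpz : G p + (q p : EReal) ≤ ((g + q z : ℝ) : EReal) := by
    refine (hp hzK).trans ?_
    simp [hz.1]
  obtain ⟨γ, -, hγ, -, hγz⟩ := exists_coe_add_of_le (hbot p) (EReal.coe_ne_bot _) hpz
  rw [hγ] at hpz
  have hpz : γ + q p ≤ g + q z := by exact_mod_cast hpz
  refine ⟨p, γ, isProx_of_forall_le hbot hconv hc hγ fun y s hs => ?_⟩
  by_cases hy : y ∈ Metric.closedBall x ‖z - x‖
  · have : G p + (q p : EReal) ≤ G y + (q y : EReal) := hp hy
    rw [hγ, hs] at this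
    exact_mod_cast this
  · have hy : ‖z - x‖ < ‖y - x‖ := by simpa [dist_eq_norm] using hy
    have h₁ : g ≤ s := by
      have := hz.2 y
      rw [hs] at this
      exact_mod_cast this
    have h₂ : q z ≤ q y := by
      have : 0 < c⁻¹ := inv_pos.2 hc
      show c⁻¹ / 2 * ‖z - x‖ ^ 2 ≤ c⁻¹ / 2 * ‖y - x‖ ^ 2
      gcongr
    show γ + q p ≤ s + q y
    linarith

variable {c : ℝ} {x p z : H} {γ g : ℝ}

theorem IsProx.le (hp : IsProx G c x p γ) (hz : IsMinVal G g z) : g ≤ γ := by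
  have := hz.2 p
  rw [hp.1] at this
  exact_mod_cast this

theorem IsProx.add_inner_le (hp : IsProx G c x p γ) (hz : IsMinVal G g z) :
    γ + c⁻¹ * ⟪x - p, z - p⟫ ≤ g := by
  have := hp.2 z
  rw [hz.1] at this
  exact_mod_cast this

/-- As `γ ≥ g`, the subgradient inequality at `z` makes the angle at `p` in the triangle `x`, `p`,
`z` right or obtuse. -/
theorem IsProx.norm_sq_add_le (hp : IsProx G c x p γ) (hc : 0 < c) (hz : IsMinVal G g z) :
    ‖p - z‖ ^ 2 + ‖p - x‖ ^ 2 ≤ ‖x - z‖ ^ 2 := by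
  have h₁ : c⁻¹ * ⟪x - p, z - p⟫ ≤ 0 := by linarith [hp.le hz, hp.add_inner_le hz]
  have h₂ : ⟪x - p, z - p⟫ ≤ 0 := by
    by_contra! h
    exact absurd h₁ (not_le.2 (mul_pos (inv_pos.2 hc) h))
  have h₃ := norm_sub_sq_real (x - p) (z - p)
  rw [sub_sub_sub_cancel_right, norm_sub_rev z p, norm_sub_rev x p] at h₃
  linarith

theorem IsProx.norm_sub_le (hp : IsProx G c x p γ) (hc : 0 < c) (hz : IsMinVal G g z) :
    ‖p - z‖ ≤ ‖x - z‖ := by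
  have := hp.norm_sq_add_le hc hz
  refine le_of_sq_le_sq ?_ (norm_nonneg _)
  linarith [sq_nonneg ‖p - x‖]

theorem IsProx.norm_sub_self_le (hp : IsProx G c x p γ) (hc : 0 < c) (hz : IsMinVal G g z) :
    ‖p - x‖ ≤ ‖x - z‖ := by
  have := hp.norm_sq_add_le hc hz
  refine le_of_sq_le_sq ?_ (norm_nonneg _)
  linarith [sq_nonneg ‖p - z‖]

theorem IsProx.le_add_norm_mul_norm (hp : IsProx G c x p γ) (hc : 0 < c) (hz : IsMinVal G g z) :
    γ ≤ g + c⁻¹ * (‖p - x‖ * ‖p - z‖) := by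
  have h₁ := hp.add_inner_le hz
  have h₂ := mul_le_mul_of_nonneg_left (abs_real_inner_le_norm (x - p) (z - p)) (inv_pos.2 hc).le
  rw [norm_sub_rev x p, norm_sub_rev z p] at h₂
  have h₃ := mul_le_mul_of_nonneg_left (neg_abs_le ⟪x - p, z - p⟫) (inv_pos.2 hc).le
  linarith

/-- One proximal step contracts the distance to the solution set `S` under quadratic growth. -/
theorem IsProx.infDist_le (hp : IsProx G c x p γ) (hc : 0 < c) {S : Set H}
    (hS : ∀ z, z ∈ S ↔ IsMinVal G g z) (hne : S.Nonempty) (hcl : IsClosed S)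
    [ProperSpace H] {κ : ℝ} (hκ : 0 < κ) (hgr : g + κ * Metric.infDist p S ^ 2 ≤ γ) :
    Metric.infDist p S ≤ 1 / √(1 + c ^ 2 * κ ^ 2) * Metric.infDist x S := by
  -- Two projections are needed: `z`, nearest to `p`, bounds the value gap; `w`, nearest to `x`,
  -- enters the Pythagorean inequality.
  obtain ⟨z, hzS, hz⟩ := hcl.exists_infDist_eq_dist hne p
  obtain ⟨w, hwS, hw⟩ := hcl.exists_infDist_eq_dist hne x
  have h₁ := hp.le_add_norm_mul_norm hc ((hS z).1 hzS)
  have h₂ := hp.norm_sq_add_le hc ((hS w).1 hwS)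
  rw [← dist_eq_norm p z, ← hz] at h₁
  rw [← dist_eq_norm x w, ← hw] at h₂
  have h₃ : Metric.infDist p S ≤ ‖p - w‖ := by
    rw [← dist_eq_norm]; exact Metric.infDist_le_dist_of_mem hwS
  set a := Metric.infDist p S
  set b := Metric.infDist x S
  have ha : 0 ≤ a := Metric.infDist_nonneg
  have hb : 0 ≤ b := Metric.infDist_nonneg
  have h₄ : c * κ * a ≤ ‖p - x‖ := by
    rcases ha.eq_or_lt with h | h
    · rw [← h]; simp
    · have h₅ : κ * a ^ 2 ≤ c⁻¹ * (‖p - x‖ * a) := by linarith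
      have h₆ := mul_le_mul_of_nonneg_left h₅ hc.le
      rw [mul_inv_cancel_left₀ hc.ne'] at h₆
      refine le_of_mul_le_mul_right ?_ h
      linarith
  have h₅ : (1 + c ^ 2 * κ ^ 2) * a ^ 2 ≤ b ^ 2 := by
    have e₁ : a ^ 2 ≤ ‖p - w‖ ^ 2 := by gcongr
    have e₂ : (c * κ * a) ^ 2 ≤ ‖p - x‖ ^ 2 := by gcongr
    nlinarith
  have hpos : 0 < 1 + c ^ 2 * κ ^ 2 := by positivity
  have hs : 0 < √(1 + c ^ 2 * κ ^ 2) := Real.sqrt_pos.2 hpos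
  rw [one_div, ← div_eq_inv_mul, le_div_iff₀ hs]
  refine le_of_sq_le_sq ?_ hb
  rw [mul_pow, Real.sq_sqrt hpos.le]
  linarith

/-- Subtracting the partial sums of `ε` leaves an antitone sequence that is bounded below. -/
theorem tendsto_of_le_add_summable {a ε : ℕ → ℝ} (ha : ∀ k, 0 ≤ a k) (hε : ∀ k, 0 ≤ ε k)
    (hs : Summable ε) (h : ∀ k, a (k + 1) ≤ a k + ε k) : ∃ l, Tendsto a atTop (𝓝 l) := by
  set b : ℕ → ℝ := fun k => a k - ∑ j ∈ Finset.range k, ε j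
  have hb : Antitone b := antitone_nat_of_succ_le fun k => by
    simp only [b, Finset.sum_range_succ]
    linarith [h k]
  have hbd : BddBelow (Set.range b) := by
    refine ⟨-∑' j, ε j, ?_⟩
    rintro _ ⟨k, rfl⟩
    have := hs.sum_le_tsum (Finset.range k) fun j _ => hε j
    simp only [b]
    linarith [ha k]
  have := (tendsto_atTop_ciInf hb hbd).add hs.hasSum.tendsto_sum_nat
  exact ⟨_, this.congr fun k => by simp [b]⟩

/-- Convergence of the inexact proximal point algorithm. -/
theorem exists_tendsto_of_isProx [FiniteDimensional ℝ H] (hlsc : LowerSemicontinuous G)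
    (hz : IsMinVal G g z) {X P : ℕ → H} {γ c ε : ℕ → ℝ} (hc : ∀ k, 0 < c k) (hmono : Monotone c)
    (hP : ∀ k, IsProx G (c k) (X k) (P k) (γ k)) (hε : ∀ k, 0 ≤ ε k) (hs : Summable ε)
    (hX : ∀ k, ‖X (k + 1) - P k‖ ≤ ε k) :
    ∃ x, IsMinVal G g x ∧ Tendsto X atTop (𝓝 x) ∧ Tendsto P atTop (𝓝 x) := by
  have fejer : ∀ w, IsMinVal G g w → ∃ l, Tendsto (fun k => ‖X k - w‖) atTop (𝓝 l) := by
    intro w hw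
    refine tendsto_of_le_add_summable (fun _ => norm_nonneg _) hε hs fun k => ?_
    have := norm_sub_le_norm_sub_add_norm_sub (X (k + 1)) (P k) w
    linarith [hX k, (hP k).norm_sub_le (hc k) hw]
  obtain ⟨l, hl⟩ := fejer z hz
  have hε0 := hs.tendsto_atTop_zero
  have hPz : Tendsto (fun k => ‖P k - z‖) atTop (𝓝 l) := by
    have h₁ : Tendsto (fun k => ‖X (k + 1) - z‖ - ε k) atTop (𝓝 l) := by
      simpa using ((tendsto_add_atTop_iff_nat 1).2 hl).sub hε0
    refine tendsto_of_tendsto_of_tendsto_of_le_of_le h₁ hl (fun k => ?_)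
      fun k => (hP k).norm_sub_le (hc k) hz
    have := norm_sub_le_norm_sub_add_norm_sub (X (k + 1)) (P k) z
    simp only
    linarith [hX k]
  -- The distances of `X k` and `P k` to `z` have the same limit, so the Pythagorean inequality
  -- leaves nothing for the step.
  have hPX : Tendsto (fun k => ‖P k - X k‖) atTop (𝓝 0) := by
    have h₁ : Tendsto (fun k => √(‖X k - z‖ ^ 2 - ‖P k - z‖ ^ 2)) atTop (𝓝 0) := by
      simpa using ((hl.pow 2).sub (hPz.pow 2)).sqrt
    refine squeeze_zero (fun _ => norm_nonneg _) (fun k => ?_) h₁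
    refine Real.le_sqrt_of_sq_le ?_
    linarith [(hP k).norm_sq_add_le (hc k) hz]
  have hval : Tendsto (fun k => g + (c 0)⁻¹ * (‖P k - X k‖ * ‖P k - z‖)) atTop (𝓝 g) := by
    simpa using ((hPX.mul hPz).const_mul (c 0)⁻¹).const_add g
  have : ProperSpace H := FiniteDimensional.proper ℝ H
  have hbdd : Bornology.IsBounded (Set.range X) := by
    obtain ⟨M, hM⟩ := hl.bddAbove_range
    refine (Metric.isBounded_closedBall (x := z) (r := M)).subset ?_
    rintro _ ⟨k, rfl⟩
    simpa [dist_eq_norm] using hM ⟨k, rfl⟩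
  obtain ⟨x, -, φ, hφ, hx⟩ := tendsto_subseq_of_bounded hbdd fun k => Set.mem_range_self k
  have toP : ∀ {ψ : ℕ → ℕ}, Tendsto ψ atTop atTop → Tendsto (X ∘ ψ) atTop (𝓝 x) →
      Tendsto (P ∘ ψ) atTop (𝓝 x) := by
    intro ψ hψ hx
    have h₁ : Tendsto (fun k => P k - X k) atTop (𝓝 0) := tendsto_zero_iff_norm_tendsto_zero.2 hPX
    have h₂ := (h₁.comp hψ).add hx
    simpa [Function.comp_def] using h₂
  have hxmin : IsMinVal G g x := by
    have h₁ := (toP hφ.tendsto_atTop hx).prodMk_nhds (hval.comp hφ.tendsto_atTop)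
    have h₂ : (x, g) ∈ epi G := by
      refine (isClosed_epi hlsc).mem_of_tendsto h₁ (Eventually.of_forall fun k => ?_)
      rw [mem_epi]
      simp only [Function.comp]
      rw [(hP _).1, EReal.coe_le_coe_iff]
      refine ((hP _).le_add_norm_mul_norm (hc _) hz).trans ?_
      -- Monotonicity of the penalties makes one constant serve for all value gaps.
      have : (c (φ k))⁻¹ ≤ (c 0)⁻¹ := inv_anti₀ (hc 0) (hmono (Nat.zero_le _))
      gcongr
    exact ⟨le_antisymm h₂ (hz.2 x), hz.2⟩
  -- The distances to the cluster point `x` converge too, and a subsequence sends them to `0`.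
  obtain ⟨m, hm⟩ := fejer x hxmin
  have hm0 : m = 0 := by
    refine tendsto_nhds_unique (hm.comp hφ.tendsto_atTop) ?_
    exact tendsto_iff_norm_sub_tendsto_zero.1 hx
  have hXx : Tendsto X atTop (𝓝 x) := tendsto_iff_norm_sub_tendsto_zero.2 (hm0 ▸ hm)
  exact ⟨x, hxmin, hXx, toP (ψ := id) tendsto_id hXx⟩

end Prox

/-! ### Duality -/

namespace Problem

variable {d e : ℕ} {𝕏 : Type*} [NormedAddCommGroup 𝕏] [InnerProductSpace ℝ 𝕏]
  {P : Problem d e 𝕏}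

/-- The primal objective with the constraint built in. -/
def primal (P : Problem d e 𝕏) (X : 𝕏) : EReal := P.Φ X + indic P.FP X

/-! ### Convexity and closedness of the primal data -/

theorem _root_.MatrixOpt.IsPolyhedralCone.convex {E : Type*} [NormedAddCommGroup E]
    [InnerProductSpace ℝ E] {Q : Set E} (hQ : IsPolyhedralCone Q) : Convex ℝ Q := by
  obtain ⟨s, rfl⟩ := hQ
  intro x hx y hy a b ha hb hab v hv
  rw [inner_add_right, real_inner_smul_right, real_inner_smul_right]
  have := hx v hv
  have := hy v hv
  positivity

theorem _root_.MatrixOpt.IsPolyhedralCone.isClosed {E : Type*} [NormedAddCommGroup E]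
    [InnerProductSpace ℝ E] {Q : Set E} (hQ : IsPolyhedralCone Q) : IsClosed Q := by
  obtain ⟨s, rfl⟩ := hQ
  simp only [Set.ofPred_forall]
  exact isClosed_iInter fun a => isClosed_iInter fun _ =>
    isClosed_le continuous_const (by fun_prop)

theorem _root_.MatrixOpt.convex_dualCone {E : Type*} [NormedAddCommGroup E]
    [InnerProductSpace ℝ E] {Q : Set E} : Convex ℝ (dualCone Q) := by
  intro x hx y hy a b ha hb hab v hv
  rw [inner_add_left, real_inner_smul_left, real_inner_smul_left]
  have := hx v hv
  have := hy v hv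
  positivity

theorem _root_.MatrixOpt.isClosed_dualCone {E : Type*} [NormedAddCommGroup E]
    [InnerProductSpace ℝ E] {Q : Set E} : IsClosed (dualCone Q) := by
  simp only [dualCone, Set.ofPred_forall]
  exact isClosed_iInter fun a => isClosed_iInter fun _ =>
    isClosed_le continuous_const (by fun_prop)

theorem Standing.convex_FP (hP : P.Standing) : Convex ℝ P.FP := by
  intro x hx y hy a b ha hb hab
  have := hP.Q_polyhedral.convex hx hy ha hb hab
  have h : P.A (a • x + b • y) - P.b = a • (P.A x - P.b) + b • (P.A y - P.b) := by
    have h₁ : P.b = a • P.b + b • P.b := by rw [← add_smul, hab, one_smul]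
    rw [map_add, map_smul, map_smul]
    nth_rewrite 1 [h₁]
    module
  show P.A (a • x + b • y) - P.b ∈ P.Q
  rwa [h]

theorem Standing.isClosed_FP [FiniteDimensional ℝ 𝕏] (hP : P.Standing) : IsClosed P.FP := by
  have : Continuous fun X => P.A X - P.b := P.A.continuous_of_finiteDimensional.sub continuous_const
  exact hP.Q_polyhedral.isClosed.preimage this

theorem Standing.Φ_ne_bot (hP : P.Standing) (X : 𝕏) : P.Φ X ≠ ⊥ := by
  rw [Φ, EReal.add_ne_bot_iff, EReal.add_ne_bot_iff]
  exact ⟨⟨hP.h_convex.1.1 _, EReal.coe_ne_bot _⟩, hP.θ_convex.1.1 _⟩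

theorem primal_of_mem {X : 𝕏} (hX : X ∈ P.FP) : P.primal X = P.Φ X := by
  simp [primal, indic_of_mem hX]

theorem Standing.primal_of_notMem (hP : P.Standing) {X : 𝕏} (hX : X ∉ P.FP) :
    P.primal X = ⊤ := by
  rw [primal, indic_of_notMem hX, EReal.add_top_of_ne_bot (hP.Φ_ne_bot X)]

/-- Bridge from the constrained problem to unconstrained minimization of `primal`, with a real
optimal value. -/
theorem Standing.exists_isMinVal (hP : P.Standing) (hΩ : P.ΩP.Nonempty) :
    ∃ g : ℝ, ∀ X, X ∈ P.ΩP ↔ IsMinVal P.primal g X := by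
  obtain ⟨X₀, hX₀, htop, hmin⟩ := hΩ
  obtain ⟨g, hg⟩ : ∃ g : ℝ, P.Φ X₀ = g := by
    have hb := hP.Φ_ne_bot X₀
    lift P.Φ X₀ to ℝ using ⟨htop, hb⟩ with g
    exact ⟨g, rfl⟩
  have hall : ∀ Y, (g : EReal) ≤ P.primal Y := by
    intro Y
    by_cases hY : Y ∈ P.FP
    · rw [primal_of_mem hY, ← hg]
      exact hmin Y hY
    · rw [hP.primal_of_notMem hY]
      exact le_top
  refine ⟨g, fun X => ⟨fun hX => ⟨?_, hall⟩, fun hX => ?_⟩⟩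
  · rw [primal_of_mem hX.1]
    exact le_antisymm ((hX.2.2 X₀ hX₀).trans hg.le) (hg.symm.le.trans (hmin X hX.1))
  · have hXF : X ∈ P.FP := by
      by_contra h
      have := hX.1
      rw [hP.primal_of_notMem h] at this
      exact EReal.top_ne_coe _ this
    have hval : P.Φ X = g := by rw [← primal_of_mem hXF, hX.1]
    refine ⟨hXF, by simp [hval], fun Y hY => ?_⟩
    rw [hval, ← hg]
    exact hmin Y hY

theorem Standing.convex_epi_Φ (hP : P.Standing) : Convex ℝ (epi P.Φ) := by
  have hh := convex_epi_comp hP.h_convex.2.2 P.F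
  have hC := convex_epi_linear (innerₛₗ ℝ P.C)
  have h₁ := convex_epi_add hh hC (fun _ => hP.h_convex.1.1 _) (fun _ => EReal.coe_ne_bot _)
  refine convex_epi_add h₁ hP.θ_convex.2.2 (fun x => ?_) hP.θ_convex.1.1
  rw [EReal.add_ne_bot_iff]
  exact ⟨hP.h_convex.1.1 _, EReal.coe_ne_bot _⟩

theorem Standing.lowerSemicontinuous_Φ [FiniteDimensional ℝ 𝕏] (hP : P.Standing) :
    LowerSemicontinuous P.Φ := by
  have hh : LowerSemicontinuous fun X => P.h (P.F X) :=
    hP.h_convex.2.1.comp P.F.continuous_of_finiteDimensional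
  have hC : Continuous fun X : 𝕏 => ((⟪P.C, X⟫ : ℝ) : EReal) :=
    continuous_coe_real_ereal.comp (by fun_prop)
  have h₁ := lowerSemicontinuous_ereal_add hh hC.lowerSemicontinuous
    (fun _ => hP.h_convex.1.1 _) (fun _ => EReal.coe_ne_bot _)
  refine lowerSemicontinuous_ereal_add h₁ hP.θ_convex.2.1 (fun x => ?_) hP.θ_convex.1.1
  rw [EReal.add_ne_bot_iff]
  exact ⟨hP.h_convex.1.1 _, EReal.coe_ne_bot _⟩

theorem Standing.primal_properClosedConvex [FiniteDimensional ℝ 𝕏] (hP : P.Standing)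
    (hΩ : P.ΩP.Nonempty) : ProperClosedConvex P.primal := by
  obtain ⟨g, hg⟩ := hP.exists_isMinVal hΩ
  obtain ⟨X₀, hX₀⟩ := hΩ
  refine ⟨⟨fun X => ?_, X₀, ?_⟩, ?_, ?_⟩
  · exact EReal.add_ne_bot_iff.2 ⟨hP.Φ_ne_bot X, indic_ne_bot⟩
  · simp [edom, ((hg X₀).1 hX₀).1]
  · exact lowerSemicontinuous_ereal_add hP.lowerSemicontinuous_Φ
      (lowerSemicontinuous_indic hP.isClosed_FP) hP.Φ_ne_bot fun _ => indic_ne_bot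
  · exact convex_epi_add hP.convex_epi_Φ (convex_epi_indic hP.convex_FP) hP.Φ_ne_bot
      fun _ => indic_ne_bot

/-! ### Convexity and closedness of the dual objective -/

theorem Standing.Ψ_ne_bot (hP : P.Standing) (Z : DualVar d e 𝕏) : P.Ψ Z ≠ ⊥ := by
  rw [Ψ, EReal.add_ne_bot_iff, EReal.add_ne_bot_iff, EReal.add_ne_bot_iff]
  exact ⟨⟨⟨indic_ne_bot, EReal.coe_ne_bot _⟩, conj_ne_bot hP.h_convex.1.2 _⟩,
    conj_ne_bot hP.θ_convex.1.2 _⟩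

theorem Standing.Ψ_le_coe (hP : P.Standing) {Z : DualVar d e 𝕏} {t : ℝ} :
    P.Ψ Z ≤ (t : EReal) ↔ Z.1 ∈ dualCone P.Q ∧ ∃ r s : ℝ, conj P.h (-Z.2.1) ≤ (r : EReal) ∧
      conj P.θ (-Z.2.2) ≤ (s : EReal) ∧ -⟪P.b, Z.1⟫ + r + s ≤ t := by
  constructor
  · intro h
    have b₁ := conj_ne_bot hP.h_convex.1.2 (-Z.2.1)
    have b₂ := conj_ne_bot hP.θ_convex.1.2 (-Z.2.2)
    have b₀ : indic (dualCone P.Q) Z.1 + ((-⟪P.b, Z.1⟫ : ℝ) : EReal) ≠ ⊥ :=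
      EReal.add_ne_bot_iff.2 ⟨indic_ne_bot, EReal.coe_ne_bot _⟩
    obtain ⟨u, s, hu, hs, hus⟩ :=
      exists_coe_add_of_le (EReal.add_ne_bot_iff.2 ⟨b₀, b₁⟩) b₂ h
    obtain ⟨v, r, hv, hr, hvr⟩ := exists_coe_add_of_le b₀ b₁ hu.le
    obtain ⟨i, j, hi, hj, hij⟩ := exists_coe_add_of_le indic_ne_bot (EReal.coe_ne_bot _) hv.le
    obtain ⟨hQ, hi'⟩ := indic_le_coe.1 hi.le
    have hj : -⟪P.b, Z.1⟫ = j := by exact_mod_cast hj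
    have : indic (dualCone P.Q) Z.1 = 0 := indic_of_mem hQ
    refine ⟨hQ, r, s, hr.le, hs.le, ?_⟩
    linarith
  · rintro ⟨hQ, r, s, hr, hs, h⟩
    rw [Ψ, indic_of_mem hQ, zero_add]
    refine (add_le_add (add_le_add le_rfl hr) hs).trans ?_
    exact_mod_cast h

theorem Standing.convex_epi_Ψ (hP : P.Standing) : Convex ℝ (epi P.Ψ) := by
  have e₁ := convex_epi_comp (V := DualVar d e 𝕏) (convex_epi_indic (convex_dualCone (Q := P.Q)))
    (LinearMap.fst ℝ (Vec e) (Vec d × 𝕏))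
  have e₂ := convex_epi_linear (V := DualVar d e 𝕏)
    (-(innerₛₗ ℝ P.b ∘ₗ LinearMap.fst ℝ (Vec e) (Vec d × 𝕏)))
  have e₃ := convex_epi_comp (V := DualVar d e 𝕏) (convex_epi_conj hP.h_convex.1.1)
    (-(LinearMap.fst ℝ (Vec d) 𝕏 ∘ₗ LinearMap.snd ℝ (Vec e) (Vec d × 𝕏)))
  have e₄ := convex_epi_comp (V := DualVar d e 𝕏) (convex_epi_conj hP.θ_convex.1.1)
    (-(LinearMap.snd ℝ (Vec d) 𝕏 ∘ₗ LinearMap.snd ℝ (Vec e) (Vec d × 𝕏)))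
  have b₁ : ∀ Z : DualVar d e 𝕏,
      indic (dualCone P.Q) Z.1 + ((-⟪P.b, Z.1⟫ : ℝ) : EReal) ≠ ⊥ := fun Z =>
    EReal.add_ne_bot_iff.2 ⟨indic_ne_bot, EReal.coe_ne_bot _⟩
  have b₂ : ∀ Z : DualVar d e 𝕏, indic (dualCone P.Q) Z.1 + ((-⟪P.b, Z.1⟫ : ℝ) : EReal) +
      conj P.h (-Z.2.1) ≠ ⊥ := fun Z =>
    EReal.add_ne_bot_iff.2 ⟨b₁ Z, conj_ne_bot hP.h_convex.1.2 _⟩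
  exact convex_epi_add (convex_epi_add (convex_epi_add e₁ e₂ (fun _ => indic_ne_bot)
    (fun _ => EReal.coe_ne_bot _)) e₃ b₁ (fun _ => conj_ne_bot hP.h_convex.1.2 _)) e₄ b₂
    (fun _ => conj_ne_bot hP.θ_convex.1.2 _)

theorem Standing.lowerSemicontinuous_Ψ (hP : P.Standing) : LowerSemicontinuous P.Ψ := by
  have e₁ : LowerSemicontinuous fun Z : DualVar d e 𝕏 => indic (dualCone P.Q) Z.1 :=
    (lowerSemicontinuous_indic isClosed_dualCone).comp continuous_fst
  have e₂ : Continuous fun Z : DualVar d e 𝕏 => ((-⟪P.b, Z.1⟫ : ℝ) : EReal) :=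
    continuous_coe_real_ereal.comp (by fun_prop)
  have e₃ : LowerSemicontinuous fun Z : DualVar d e 𝕏 => conj P.h (-Z.2.1) :=
    (lowerSemicontinuous_conj hP.h_convex.1.1).comp (by fun_prop)
  have e₄ : LowerSemicontinuous fun Z : DualVar d e 𝕏 => conj P.θ (-Z.2.2) :=
    (lowerSemicontinuous_conj hP.θ_convex.1.1).comp (by fun_prop)
  have b₁ : ∀ Z : DualVar d e 𝕏,
      indic (dualCone P.Q) Z.1 + ((-⟪P.b, Z.1⟫ : ℝ) : EReal) ≠ ⊥ := fun Z =>
    EReal.add_ne_bot_iff.2 ⟨indic_ne_bot, EReal.coe_ne_bot _⟩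
  have b₂ : ∀ Z : DualVar d e 𝕏, indic (dualCone P.Q) Z.1 + ((-⟪P.b, Z.1⟫ : ℝ) : EReal) +
      conj P.h (-Z.2.1) ≠ ⊥ := fun Z =>
    EReal.add_ne_bot_iff.2 ⟨b₁ Z, conj_ne_bot hP.h_convex.1.2 _⟩
  exact lowerSemicontinuous_ereal_add (lowerSemicontinuous_ereal_add
    (lowerSemicontinuous_ereal_add e₁ e₂.lowerSemicontinuous (fun _ => indic_ne_bot)
    (fun _ => EReal.coe_ne_bot _)) e₃ b₁ (fun _ => conj_ne_bot hP.h_convex.1.2 _)) e₄ b₂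
    (fun _ => conj_ne_bot hP.θ_convex.1.2 _)

/-- Completing the square in `R`. With `p` the proximal point it measures inexactness; with `p = 0`
it gives the objective gap bound. -/
theorem _root_.MatrixOpt.norm_sq_step {H : Type*} [NormedAddCommGroup H]
    [InnerProductSpace ℝ H] {c : ℝ} (hc : 0 < c) (X p R : H) :
    ⟪X, R⟫ + c / 2 * ‖R‖ ^ 2 =
      ⟪p, R⟫ + (1 / (2 * c) * ‖X + c • R - p‖ ^ 2 - 1 / (2 * c) * ‖p - X‖ ^ 2) := by
  have h : X + c • R - p = c • R - (p - X) := by abel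
  rw [h, norm_sub_sq_real, norm_smul, mul_pow, Real.norm_eq_abs, sq_abs, real_inner_smul_left,
    inner_sub_right, real_inner_comm p R, real_inner_comm X R]
  field_simp
  ring

variable [FiniteDimensional ℝ 𝕏]

/-! ### Lagrangian duality -/

theorem inner_res (P : Problem d e 𝕏) (X : 𝕏) (Z : DualVar d e 𝕏) :
    ⟪X, P.res Z⟫ = ⟪Z.1, P.A X⟫ + ⟪Z.2.1, P.F X⟫ + ⟪Z.2.2, X⟫ - ⟪P.C, X⟫ := by
  rw [real_inner_comm, res, inner_sub_left, inner_add_left, inner_add_left,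
    LinearMap.adjoint_inner_left, LinearMap.adjoint_inner_left]

theorem continuous_res (P : Problem d e 𝕏) : Continuous P.res := by
  have h₁ := (LinearMap.adjoint P.A).continuous_of_finiteDimensional
  have h₂ := (LinearMap.adjoint P.F).continuous_of_finiteDimensional
  unfold res
  fun_prop

theorem res_combo (P : Problem d e 𝕏) (Z W : DualVar d e 𝕏) {a b : ℝ} (hab : a + b = 1) :
    P.res (a • Z + b • W) = a • P.res Z + b • P.res W := by
  have h₁ : P.C = a • P.C + b • P.C := by rw [← add_smul, hab, one_smul]
  simp only [res, Prod.fst_add, Prod.snd_add, Prod.smul_fst, Prod.smul_snd, map_add, map_smul]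
  nth_rewrite 1 [h₁]
  module

/-- Weak duality. -/
theorem Standing.neg_le_lag (hP : P.Standing) {X : 𝕏} {Z : DualVar d e 𝕏} {s t : ℝ}
    (hX : P.primal X ≤ (s : EReal)) (hZ : P.Ψ Z ≤ (t : EReal)) : -s ≤ t + ⟪X, P.res Z⟫ := by
  have hF : X ∈ P.FP := by
    by_contra h
    rw [hP.primal_of_notMem h] at hX
    simp at hX
  rw [primal_of_mem hF, Φ] at hX
  obtain ⟨u, s₃, hu, hs₃, hus⟩ := exists_coe_add_of_le (EReal.add_ne_bot_iff.2
    ⟨hP.h_convex.1.1 _, EReal.coe_ne_bot _⟩) (hP.θ_convex.1.1 _) hX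
  obtain ⟨s₁, s₂, hs₁, hs₂, hs⟩ :=
    exists_coe_add_of_le (hP.h_convex.1.1 _) (EReal.coe_ne_bot _) hu.le
  have hs₂ : ⟪P.C, X⟫ = s₂ := by exact_mod_cast hs₂
  obtain ⟨hQ, r₁, r₂, hr₁, hr₂, hr⟩ := hP.Ψ_le_coe.1 hZ
  have f₁ := le_add_of_conj_le hP.h_convex.1.1 hs₁.le hr₁
  have f₂ := le_add_of_conj_le hP.θ_convex.1.1 hs₃.le hr₂
  have f₃ := hQ _ hF
  rw [inner_neg_left] at f₁ f₂
  rw [inner_sub_right, real_inner_comm P.b Z.1] at f₃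
  rw [inner_res]
  linarith

/-- The primal function is the negative of the dual function of the Lagrangian. -/
theorem Standing.primal_le_of_le_lag (hP : P.Standing) {X : 𝕏} {α : ℝ}
    (h : ∀ (Z : DualVar d e 𝕏) (t : ℝ), P.Ψ Z ≤ (t : EReal) → α ≤ t + ⟪X, P.res Z⟫) :
    P.primal X ≤ ((-α : ℝ) : EReal) := by
  -- The Lagrangian decouples in `y`, `w`, `S`, so each block can be chosen separately.
  have key : ∀ (y : Vec e) (w : Vec d) (S : 𝕏) (r s : ℝ), y ∈ dualCone P.Q →
      conj P.h w ≤ (r : EReal) → conj P.θ S ≤ (s : EReal) →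
      α ≤ ⟪y, P.A X - P.b⟫ - (⟪w, P.F X⟫ - r) - (⟪S, X⟫ - s) - ⟪P.C, X⟫ := by
    intro y w S r s hy hw hS
    have h₁ := h (y, -w, -S) (-⟪P.b, y⟫ + r + s)
      (hP.Ψ_le_coe.2 ⟨hy, r, s, by simpa using hw, by simpa using hS, le_rfl⟩)
    rw [inner_res] at h₁
    simp only [inner_neg_left] at h₁
    rw [inner_sub_right, real_inner_comm P.b y]
    linarith
  obtain ⟨w₀, r₀, hw₀⟩ := hP.h_convex.exists_conj_real
  obtain ⟨S₀, s₀, hS₀⟩ := hP.θ_convex.exists_conj_real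
  have hF : X ∈ P.FP := by
    show P.A X - P.b ∈ P.Q
    obtain ⟨σ, hσ⟩ := hP.Q_polyhedral
    rw [hσ]
    intro a ha
    by_contra! hneg
    set β := -(⟪w₀, P.F X⟫ - r₀) - (⟪S₀, X⟫ - s₀) - ⟪P.C, X⟫
    -- The normal `a` of a violated half-space lies in the dual cone; large multiples of it push the
    -- Lagrangian below `α`.
    obtain ⟨n, hn⟩ := exists_nat_gt ((β - α) / -⟪a, P.A X - P.b⟫)
    rw [div_lt_iff₀ (by linarith)] at hn
    have hmem : (n : ℝ) • a ∈ dualCone P.Q := by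
      intro q hq
      rw [hσ] at hq
      rw [real_inner_smul_left]
      exact mul_nonneg (Nat.cast_nonneg n) (hq a ha)
    have := key _ _ _ _ _ hmem hw₀ hS₀
    rw [real_inner_smul_left] at this
    linarith
  have zero_mem : (0 : Vec e) ∈ dualCone P.Q := fun q _ => by simp
  have sum_le : ∀ r₁ r₂ : ℝ, (r₁ : EReal) < P.h (P.F X) → (r₂ : EReal) < P.θ X →
      r₁ + r₂ ≤ -α - ⟪P.C, X⟫ := by
    intro r₁ r₂ h₁ h₂
    obtain ⟨w, r, hw, hr⟩ := hP.h_convex.exists_conj_le h₁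
    obtain ⟨S, s, hS, hs⟩ := hP.θ_convex.exists_conj_le h₂
    have := key _ _ _ _ _ zero_mem hw hS
    rw [inner_zero_left] at this
    linarith
  have h_le : ∀ r₂ : ℝ, (r₂ : EReal) < P.θ X →
      P.h (P.F X) ≤ ((-α - ⟪P.C, X⟫ - r₂ : ℝ) : EReal) := by
    intro r₂ h₂
    by_contra! hlt
    obtain ⟨r₁, h₁, h₁'⟩ := EReal.lt_iff_exists_real_btwn.1 hlt
    have h₁ : -α - ⟪P.C, X⟫ - r₂ < r₁ := by exact_mod_cast h₁
    linarith [sum_le r₁ r₂ h₁' h₂]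
  -- Any real below `θ` at `X` already shows that `h` is finite at `F X`; its exact value then
  -- bounds `θ`.
  obtain ⟨r₂, -, hr₂⟩ := EReal.lt_iff_exists_real_btwn.1 (bot_lt_iff_ne_bot.2 (hP.θ_convex.1.1 X))
  obtain ⟨η, hη, -⟩ := exists_coe_of_le (hP.h_convex.1.1 _) (h_le r₂ hr₂)
  have θ_le : P.θ X ≤ ((-α - ⟪P.C, X⟫ - η : ℝ) : EReal) := by
    by_contra! hlt
    obtain ⟨r, h₁, h₁'⟩ := EReal.lt_iff_exists_real_btwn.1 hlt
    have h₁ : -α - ⟪P.C, X⟫ - η < r := by exact_mod_cast h₁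
    have h₂ := h_le r h₁'
    rw [hη] at h₂
    have h₂ : η ≤ -α - ⟪P.C, X⟫ - r := by exact_mod_cast h₂
    linarith
  rw [primal_of_mem hF, Φ, hη]
  refine (add_le_add le_rfl θ_le).trans ?_
  norm_cast
  linarith

/-! ### Subproblem values and inexactness of the proximal step -/

theorem augLag_of_eq {Z : DualVar d e 𝕏} {t : ℝ} (h : P.Ψ Z = t) (c : ℝ) (X : 𝕏) :
    P.augLag c Z X = ((t + ⟪X, P.res Z⟫ + c / 2 * ‖P.res Z‖ ^ 2 : ℝ) : EReal) := by
  rw [augLag, lag, h]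
  norm_cast

theorem augLag_of_eq_top {Z : DualVar d e 𝕏} (h : P.Ψ Z = ⊤) (c : ℝ) (X : 𝕏) :
    P.augLag c Z X = ⊤ := by
  rw [augLag, lag, h, EReal.top_add_coe, EReal.top_add_coe]

variable {c γ : ℝ} {X p : 𝕏}

theorem Standing.neg_add_le_augLag (hP : P.Standing) (hc : 0 < c)
    (hp : IsProx P.primal c X p γ) {Z : DualVar d e 𝕏} {t : ℝ} (ht : P.Ψ Z ≤ (t : EReal)) :
    -γ - 1 / (2 * c) * ‖p - X‖ ^ 2 + 1 / (2 * c) * ‖X + c • P.res Z - p‖ ^ 2 ≤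
      t + ⟪X, P.res Z⟫ + c / 2 * ‖P.res Z‖ ^ 2 := by
  have h₁ := hP.neg_le_lag hp.1.le ht
  have h₂ := norm_sq_step hc X p (P.res Z)
  linarith

/-- Strong duality for the subproblems: the optimal value is the negative of the Moreau envelope
of the primal function. -/
theorem Standing.iInf_augLag (hP : P.Standing) (hc : 0 < c)
    (hp : IsProx P.primal c X p γ) :
    ⨅ Z, P.augLag c Z X = ((-γ - 1 / (2 * c) * ‖p - X‖ ^ 2 : ℝ) : EReal) := by
  have hpos : 0 < 1 / (2 * c) := by positivity
  apply le_antisymm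
  · set K : Set (𝕏 × ℝ) := {q | ∃ Z, P.res Z = q.1 ∧ P.Ψ Z ≤ (q.2 : EReal)}
    have hKconv : Convex ℝ K := by
      rintro ⟨u, s⟩ ⟨Z, rfl, hZ⟩ ⟨v, t⟩ ⟨W, rfl, hW⟩ a b ha hb hab
      exact ⟨a • Z + b • W, by simp [P.res_combo Z W hab],
        @convex_epi_Ψ _ _ _ _ _ _ hP (Z, s) hZ (W, t) hW a b ha hb hab⟩
    have hKup : ∀ u s t, (u, s) ∈ closure K → s ≤ t → (u, t) ∈ closure K := by
      intro u s t hs hst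
      have hmap : Set.MapsTo (fun q : 𝕏 × ℝ => (q.1, q.2 + (t - s))) K K := by
        rintro ⟨v, r⟩ ⟨Z, hZ, hZ'⟩
        refine ⟨Z, hZ, hZ'.trans ?_⟩
        simp only [EReal.coe_le_coe_iff]
        linarith
      have := map_mem_closure (by fun_prop) hs hmap
      simpa using this
    have hKmin : ∀ q ∈ closure K, -γ ≤ q.2 + ⟪p, q.1⟫ := by
      intro q hq
      have hcl : IsClosed {q : 𝕏 × ℝ | -γ ≤ q.2 + ⟪p, q.1⟫} :=
        isClosed_le continuous_const (by fun_prop)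
      refine closure_minimal ?_ hcl hq
      rintro ⟨u, t⟩ ⟨Z, rfl, hZ⟩
      exact hP.neg_le_lag hp.1.le hZ
    -- The residual an exact subproblem solution would have, since it moves `X` to `p`.
    set U := c⁻¹ • (p - X)
    have hmem : (U, -γ - ⟪p, U⟫) ∈ closure K := by
      by_contra hnot
      -- A separating minorant has some slope `Y`; by duality `primal Y ≤ -a`, which contradicts the
      -- subgradient inequality at `p`.
      obtain ⟨Y, a, h₁, h₂⟩ := exists_affine_minorant hKconv.closure isClosed_closure hKup
        hKmin hnot
      have h₃ := hP.primal_le_of_le_lag (X := Y) fun Z t ht =>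
        h₂ (P.res Z, t) (subset_closure ⟨Z, rfl, ht⟩)
      have h₄ := (hp.2 Y).trans h₃
      have h₄ : γ + c⁻¹ * ⟪X - p, Y - p⟫ ≤ -a := by exact_mod_cast h₄
      have h₅ : c⁻¹ * ⟪X - p, Y - p⟫ = ⟪p, U⟫ - ⟪Y, U⟫ := by
        simp only [U, real_inner_smul_right]
        rw [← neg_sub p X, inner_neg_left, inner_sub_right, real_inner_comm Y, real_inner_comm p]
        ring
      simp only at h₁
      linarith
    refine le_of_forall_gt_imp_ge_of_dense fun m hm => ?_
    obtain ⟨m', hm', hmm'⟩ := EReal.lt_iff_exists_real_btwn.1 hm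
    have hm' : -γ - 1 / (2 * c) * ‖p - X‖ ^ 2 < m' := by exact_mod_cast hm'
    have hcont : Continuous fun q : 𝕏 × ℝ => q.2 + ⟪X, q.1⟫ + c / 2 * ‖q.1‖ ^ 2 := by fun_prop
    have hval : (-γ - ⟪p, U⟫) + ⟪X, U⟫ + c / 2 * ‖U‖ ^ 2 = -γ - 1 / (2 * c) * ‖p - X‖ ^ 2 := by
      have h₁ := norm_sq_step hc X p U
      have h₂ : X + c • U - p = 0 := by
        simp only [U, smul_inv_smul₀ hc.ne']
        abel
      rw [h₂, norm_zero] at h₁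
      linarith
    have hopen : IsOpen {q : 𝕏 × ℝ | q.2 + ⟪X, q.1⟫ + c / 2 * ‖q.1‖ ^ 2 < m'} :=
      isOpen_lt hcont continuous_const
    obtain ⟨⟨u, t⟩, hlt, Z, hZ, hZ'⟩ := mem_closure_iff.1 hmem _ hopen (by
      show (-γ - ⟪p, U⟫) + ⟪X, U⟫ + c / 2 * ‖U‖ ^ 2 < m'
      rwa [hval])
    simp only at hZ hZ'
    subst hZ
    obtain ⟨t', ht', htt'⟩ := exists_coe_of_le (hP.Ψ_ne_bot Z) hZ'
    refine (iInf_le _ Z).trans (le_trans ?_ hmm'.le)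
    rw [augLag_of_eq ht', EReal.coe_le_coe_iff]
    have hlt : t + ⟪X, P.res Z⟫ + c / 2 * ‖P.res Z‖ ^ 2 < m' := hlt
    linarith
  · refine le_iInf fun Z => ?_
    by_cases hZ : P.Ψ Z = ⊤
    · rw [augLag_of_eq_top hZ]
      exact le_top
    · obtain ⟨t, ht⟩ : ∃ t : ℝ, P.Ψ Z = t := by
        have hb := hP.Ψ_ne_bot Z
        lift P.Ψ Z to ℝ using ⟨hZ, hb⟩ with t
        exact ⟨t, rfl⟩
      rw [augLag_of_eq ht, EReal.coe_le_coe_iff]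
      have := hP.neg_add_le_augLag hc hp ht.le
      have : 0 ≤ 1 / (2 * c) * ‖X + c • P.res Z - p‖ ^ 2 := by positivity
      linarith

/-- The infimum is finite, so a gap bounded by a real rules out `Ψ = ⊤`; afterwards all arithmetic
is real. -/
theorem Standing.exists_subGap (hP : P.Standing) (hc : 0 < c)
    (hp : IsProx P.primal c X p γ) {Z : DualVar d e 𝕏} {δ : ℝ}
    (hZ : P.subGap c X Z ≤ (δ : EReal)) :
    ∃ t : ℝ, P.Ψ Z = t ∧ P.subGap c X Z = ((t + ⟪X, P.res Z⟫ + c / 2 * ‖P.res Z‖ ^ 2 -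
      (-γ - 1 / (2 * c) * ‖p - X‖ ^ 2) : ℝ) : EReal) := by
  have htop : P.Ψ Z ≠ ⊤ := by
    intro h
    rw [subGap, hP.iInf_augLag hc hp, augLag_of_eq_top h, EReal.top_sub_coe] at hZ
    simp at hZ
  obtain ⟨t, ht⟩ : ∃ t : ℝ, P.Ψ Z = t := by
    have hb := hP.Ψ_ne_bot Z
    lift P.Ψ Z to ℝ using ⟨htop, hb⟩ with t
    exact ⟨t, rfl⟩
  refine ⟨t, ht, ?_⟩
  rw [subGap, hP.iInf_augLag hc hp, augLag_of_eq ht, ← EReal.coe_sub]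

/-- The distance of the updated multiplier from the exact proximal point. -/
theorem Standing.norm_sub_prox_sq_le (hP : P.Standing) (hc : 0 < c)
    (hp : IsProx P.primal c X p γ) {Z : DualVar d e 𝕏} {δ : ℝ}
    (hZ : P.subGap c X Z ≤ (δ : EReal)) : ‖X + c • P.res Z - p‖ ^ 2 ≤ 2 * c * δ := by
  obtain ⟨t, ht, hgap⟩ := hP.exists_subGap hc hp hZ
  have h₁ := hP.neg_add_le_augLag hc hp ht.le
  rw [hgap, EReal.coe_le_coe_iff] at hZ
  have h₂ : 1 / (2 * c) * ‖X + c • P.res Z - p‖ ^ 2 ≤ δ := by linarith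
  rw [one_div, ← div_eq_inv_mul, div_le_iff₀ (by positivity)] at h₂
  linarith

theorem Standing.iInf_augLag_le_Ψopt (hP : P.Standing) (c : ℝ) (X : 𝕏) :
    ⨅ Z, P.augLag c Z X ≤ P.Ψopt := by
  refine le_iInf₂ fun Z hZ => (iInf_le _ Z).trans ?_
  by_cases h : P.Ψ Z = ⊤
  · rw [h]
    exact le_top
  · obtain ⟨t, ht⟩ : ∃ t : ℝ, P.Ψ Z = t := by
      have hb := hP.Ψ_ne_bot Z
      lift P.Ψ Z to ℝ using ⟨h, hb⟩ with t
      exact ⟨t, rfl⟩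
    rw [augLag_of_eq ht, ht, hZ.1]
    simp

theorem Standing.Ψ_sub_Ψopt_le (hP : P.Standing) (hc : 0 < c)
    (hp : IsProx P.primal c X p γ) {Z : DualVar d e 𝕏} {δ : ℝ}
    (hZ : P.subGap c X Z ≤ (δ : EReal)) :
    P.Ψ Z - P.Ψopt ≤ P.subGap c X Z +
      ((1 / (2 * c) * (‖X‖ ^ 2 - ‖X + c • P.res Z‖ ^ 2) : ℝ) : EReal) := by
  obtain ⟨t, ht, hgap⟩ := hP.exists_subGap hc hp hZ
  have h₁ := hP.iInf_augLag_le_Ψopt c X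
  rw [hP.iInf_augLag hc hp] at h₁
  -- Only a finite lower bound for `Ψopt` is used, so an infinite dual value is allowed.
  refine (EReal.sub_le_sub ht.le h₁).trans ?_
  rw [hgap, ← EReal.coe_sub, ← EReal.coe_add, EReal.coe_le_coe_iff]
  have h₂ := norm_sq_step hc X 0 (P.res Z)
  simp only [inner_zero_left, sub_zero, zero_sub, norm_neg] at h₂
  linarith

end Problem

/-! ### The dual sequence -/

namespace Problem

variable {d e : ℕ} {𝕏 : Type*} [NormedAddCommGroup 𝕏] [InnerProductSpace ℝ 𝕏]
  {P : Problem d e 𝕏} [FiniteDimensional ℝ 𝕏]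

/-- Among points with zero residual, optimality is a sublevel condition on `Ψ`: the cone constraint
is built into its finiteness. -/
theorem Standing.exists_mem_ΩD (hP : P.Standing) (hD : P.ΩD.Nonempty) :
    ∃ v : ℝ, P.Ψopt = v ∧ ∀ Z, P.res Z = 0 → (Z ∈ P.ΩD ↔ P.Ψ Z ≤ (v : EReal)) := by
  obtain ⟨Z₀, hF, htop, hmin⟩ := hD
  obtain ⟨v, hv⟩ : ∃ v : ℝ, P.Ψ Z₀ = v := by
    have hb := hP.Ψ_ne_bot Z₀
    lift P.Ψ Z₀ to ℝ using ⟨htop, hb⟩ with v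
    exact ⟨v, rfl⟩
  refine ⟨v, ?_, fun Z hZ => ⟨fun h => hv ▸ h.2.2 Z₀ hF, fun h => ?_⟩⟩
  · rw [← hv]
    exact le_antisymm (iInf₂_le Z₀ hF) (le_iInf₂ hmin)
  · refine ⟨⟨hZ, (hP.Ψ_le_coe.1 h).1⟩, ne_top_of_le_ne_top (EReal.coe_ne_top v) h, fun W hW => ?_⟩
    exact h.trans (hv ▸ hmin W hW)

variable {v : ℝ} {Z : ℕ → DualVar d e 𝕏} {δ : ℕ → ℝ}

theorem Standing.mem_ΩD_of_tendsto (hP : P.Standing)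
    (hv : ∀ Z, P.res Z = 0 → (Z ∈ P.ΩD ↔ P.Ψ Z ≤ (v : EReal)))
    (hδ : Tendsto δ atTop (𝓝 0)) (hΨ : ∀ᶠ k in atTop, P.Ψ (Z k) ≤ ((v + δ k : ℝ) : EReal))
    (hres : Tendsto (fun k => P.res (Z k)) atTop (𝓝 0)) {W : DualVar d e 𝕏}
    (hW : Tendsto Z atTop (𝓝 W)) : W ∈ P.ΩD := by
  have h₀ : P.res W = 0 := tendsto_nhds_unique ((P.continuous_res.tendsto W).comp hW) hres
  have h₁ : Tendsto (fun k => v + δ k) atTop (𝓝 v) := by simpa using hδ.const_add v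
  have h₂ : (W, v) ∈ epi P.Ψ :=
    (isClosed_epi hP.lowerSemicontinuous_Ψ).mem_of_tendsto (hW.prodMk_nhds h₁) hΨ
  exact (hv W h₀).2 h₂

theorem Standing.isBounded_range_of_isBounded_ΩD (hP : P.Standing)
    (hv : ∀ Z, P.res Z = 0 → (Z ∈ P.ΩD ↔ P.Ψ Z ≤ (v : EReal)))
    (hne : P.ΩD.Nonempty) (hbdd : Bornology.IsBounded P.ΩD)
    (hδ : Tendsto δ atTop (𝓝 0)) (hΨ : ∀ᶠ k in atTop, P.Ψ (Z k) ≤ ((v + δ k : ℝ) : EReal))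
    (hres : Tendsto (fun k => P.res (Z k)) atTop (𝓝 0)) :
    Bornology.IsBounded (Set.range Z) := by
  obtain ⟨Z₀, hZ₀⟩ := hne
  have hres₀ : P.res Z₀ = 0 := hZ₀.1.1
  have hΨ₀ := (hv Z₀ hres₀).1 hZ₀
  obtain ⟨r, hr, hsub⟩ := hbdd.subset_ball_lt 0 Z₀
  have : ProperSpace (DualVar d e 𝕏) := FiniteDimensional.proper ℝ _
  have hev : ∀ᶠ k in atTop, Z k ∈ Metric.ball Z₀ r := by
    by_contra hcon
    have hfreq := (not_eventually.1 hcon).and_eventually hΨ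
    obtain ⟨φ, hφ, hφ'⟩ := extraction_of_frequently_atTop hfreq
    have hfar : ∀ n, r ≤ ‖Z (φ n) - Z₀‖ := fun n => by
      simpa [dist_eq_norm] using (hφ' n).1
    set s : ℕ → ℝ := fun n => r / ‖Z (φ n) - Z₀‖
    have hs0 : ∀ n, 0 ≤ s n := fun n => by positivity
    have hs1 : ∀ n, s n ≤ 1 := fun n => div_le_one_of_le₀ (hfar n) (norm_nonneg _)
    -- Pull the far iterates back to the sphere of radius `r`; convexity keeps their values nearly
    -- optimal and affinity of the residual keeps them nearly feasible.
    set V : ℕ → DualVar d e 𝕏 := fun n => (1 - s n) • Z₀ + s n • Z (φ n)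
    have hVr : ∀ n, V n ∈ Metric.sphere Z₀ r := fun n => by
      have h₁ : V n - Z₀ = s n • (Z (φ n) - Z₀) := by simp only [V]; module
      have h₂ : ‖Z (φ n) - Z₀‖ ≠ 0 := (hr.trans_le (hfar n)).ne'
      rw [mem_sphere_iff_norm, h₁, norm_smul, Real.norm_eq_abs, abs_of_nonneg (hs0 n)]
      exact div_mul_cancel₀ _ h₂
    have hVΨ : ∀ n, P.Ψ (V n) ≤ ((v + |δ (φ n)| : ℝ) : EReal) := fun n => by
      have h₁ := @convex_epi_Ψ _ _ _ _ _ _ hP (Z₀, v) hΨ₀ (Z (φ n), v + δ (φ n)) (hφ' n).2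
        (1 - s n) (s n) (by linarith [hs1 n]) (hs0 n) (by ring)
      refine le_trans (mem_epi.1 h₁) ?_
      rw [EReal.coe_le_coe_iff]
      simp only [Prod.smul_mk, Prod.mk_add_mk, smul_eq_mul]
      have h₂ : s n * δ (φ n) ≤ 1 * |δ (φ n)| :=
        (mul_le_mul_of_nonneg_left (le_abs_self _) (hs0 n)).trans
          (mul_le_mul_of_nonneg_right (hs1 n) (abs_nonneg _))
      linarith
    have hVres : Tendsto (fun n => P.res (V n)) atTop (𝓝 0) := by
      refine squeeze_zero_norm (fun n => ?_) 
        (tendsto_zero_iff_norm_tendsto_zero.1 (hres.comp hφ.tendsto_atTop))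
      rw [P.res_combo _ _ (by ring), hres₀, smul_zero, zero_add, norm_smul, Real.norm_eq_abs,
        abs_of_nonneg (hs0 n)]
      exact mul_le_of_le_one_left (norm_nonneg _) (hs1 n)
    obtain ⟨W, hW, ψ, hψ, hlim⟩ := (isCompact_sphere Z₀ r).tendsto_subseq hVr
    have hδ' : Tendsto (fun n => |δ (φ (ψ n))|) atTop (𝓝 0) := by
      simpa using ((hδ.comp hφ.tendsto_atTop).comp hψ.tendsto_atTop).abs
    have hWΩ := hP.mem_ΩD_of_tendsto hv hδ' (Eventually.of_forall fun n => hVΨ (ψ n))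
      (hVres.comp hψ.tendsto_atTop) hlim
    exact (Metric.mem_ball.1 (hsub hWΩ)).ne (Metric.mem_sphere.1 hW)
  obtain ⟨N, hN⟩ := eventually_atTop.1 hev
  refine (((Set.finite_Iio N).image Z).isBounded.union
    (Metric.isBounded_ball (x := Z₀) (r := r))).subset ?_
  rintro _ ⟨k, rfl⟩
  rcases lt_or_ge k N with h | h
  · exact Or.inl ⟨k, h, rfl⟩
  · exact Or.inr (hN k h)

end Problem

/-! ### Limits of the rates -/

theorem tendsto_real_of_tendsto_ofReal {c : ℕ → ℝ} (hc : ∀ k, 0 < c k) (hmono : Monotone c)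
    {cInf : ℝ≥0∞} (h : Tendsto (fun k => ENNReal.ofReal (c k)) atTop (𝓝 cInf)) :
    (cInf = ⊤ ∧ Tendsto c atTop atTop) ∨
      (cInf ≠ ⊤ ∧ 0 < cInf.toReal ∧ Tendsto c atTop (𝓝 cInf.toReal)) := by
  by_cases htop : cInf = ⊤
  · subst htop
    exact Or.inl ⟨rfl, ENNReal.tendsto_ofReal_nhds_top.1 h⟩
  · have h₁ : Tendsto c atTop (𝓝 cInf.toReal) :=
      ((ENNReal.tendsto_toReal htop).comp h).congr fun k => ENNReal.toReal_ofReal (hc k).le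
    exact Or.inr ⟨htop, (hc 0).trans_le (hmono.ge_of_tendsto h₁ 0), h₁⟩

section Rates

variable {c η : ℕ → ℝ} {cInf : ℝ≥0∞} {κ : ℝ} (hc : ∀ k, 0 < c k) (hmono : Monotone c)
  (h : Tendsto (fun k => ENNReal.ofReal (c k)) atTop (𝓝 cInf))
include hc hmono h

theorem rateθInf_lt_one (hκ : 0 < κ) : rateθInf κ cInf < 1 := by
  rcases tendsto_real_of_tendsto_ofReal hc hmono h with ⟨ht, -⟩ | ⟨ht, hpos, -⟩
  · simp [rateθInf, ht]
  · rw [rateθInf, if_neg ht]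
    have : 0 < cInf.toReal ^ 2 * κ ^ 2 := by positivity
    rw [div_lt_one (by positivity), Real.lt_sqrt zero_le_one]
    linarith

theorem tendsto_rateμ (hκ : 0 < κ) : Tendsto (rateμ κ c) atTop (𝓝 (rateθInf κ cInf)) := by
  rcases tendsto_real_of_tendsto_ofReal hc hmono h with ⟨ht, hlim⟩ | ⟨ht, hpos, hlim⟩
  · rw [rateθInf, if_pos ht]
    have h₁ : Tendsto (fun k => √(1 + c k ^ 2 * κ ^ 2)) atTop atTop := by
      refine Real.tendsto_sqrt_atTop.comp (tendsto_atTop_add_const_left _ _ ?_)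
      exact ((tendsto_pow_atTop two_ne_zero).comp hlim).atTop_mul_const (by positivity)
    exact h₁.inv_tendsto_atTop.congr fun k => (one_div _).symm
  · rw [rateθInf, if_neg ht]
    refine Tendsto.div tendsto_const_nhds
      ((((hlim.pow 2).mul_const (κ ^ 2)).const_add 1).sqrt) ?_
    positivity

theorem tendsto_inv_penalty : Tendsto (fun k => (c k)⁻¹) atTop (𝓝 (invInf cInf)) := by
  rcases tendsto_real_of_tendsto_ofReal hc hmono h with ⟨ht, hlim⟩ | ⟨ht, hpos, hlim⟩
  · rw [invInf, if_pos ht]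
    exact hlim.inv_tendsto_atTop
  · rw [invInf, if_neg ht, one_div]
    exact hlim.inv₀ hpos.ne'

theorem tendsto_rateθ (hκ : 0 < κ) (hη : Tendsto η atTop (𝓝 0)) :
    Tendsto (rateθ κ c η) atTop (𝓝 (rateθInf κ cInf)) := by
  have h₁ : Tendsto (fun k => (1 - η k)⁻¹) atTop (𝓝 1) := by
    simpa using (hη.const_sub 1).inv₀ (by simp)
  change Tendsto (fun k => (rateμ κ c k + 2 * η k) * (1 - η k)⁻¹) atTop _
  simpa using ((tendsto_rateμ hc hmono h hκ).add (hη.const_mul 2)).mul h₁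

theorem tendsto_rateτ₁ (hη : Tendsto η atTop (𝓝 0)) :
    Tendsto (rateτ₁ c η) atTop (𝓝 (invInf cInf)) := by
  have h₁ : Tendsto (fun k => (1 - η k)⁻¹) atTop (𝓝 1) := by
    simpa using (hη.const_sub 1).inv₀ (by simp)
  change Tendsto (fun k => (c k)⁻¹ * (1 - η k)⁻¹) atTop _
  simpa using (tendsto_inv_penalty hc hmono h).mul h₁

theorem tendsto_rateτ₂ {𝕏 : Type*} [NormedAddCommGroup 𝕏] [InnerProductSpace ℝ 𝕏]
    (hη : Tendsto η atTop (𝓝 0)) {X : ℕ → 𝕏} {x : 𝕏} (hX : Tendsto X atTop (𝓝 x)) :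
    Tendsto (rateτ₂ c η X) atTop (𝓝 (‖x‖ * invInf cInf)) := by
  have hX' : Tendsto (fun k => X (k + 1)) atTop (𝓝 x) := (tendsto_add_atTop_iff_nat 1).2 hX
  have h₁ := (((hη.pow 2).mul (hX'.sub hX).norm).add hX'.norm).add hX.norm
  have h₂ := ((tendsto_rateτ₁ hc hmono h hη).mul h₁).div_const 2
  have h₃ : invInf cInf * (0 ^ 2 * ‖x - x‖ + ‖x‖ + ‖x‖) / 2 = ‖x‖ * invInf cInf := by
    simp
    ring
  rw [h₃] at h₂
  exact h₂

end Rates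

/-! ### Rates of one step -/

/-- The estimates of one step under the second stopping criterion, where `p` is the exact proximal
point and `r` is the contraction factor of the exact step. -/
theorem step_rates {H : Type*} [NormedAddCommGroup H] {S : Set H} {X Y p : H} {η r : ℝ}
    (hη : 0 ≤ η) (hη1 : η < 1) (h₁ : ‖Y - p‖ ≤ η * ‖Y - X‖)
    (h₂ : ‖p - X‖ ≤ Metric.infDist X S)
    (h₃ : Metric.infDist p S ≤ r * Metric.infDist X S) :
    ‖Y - X‖ ≤ (1 - η)⁻¹ * Metric.infDist X S ∧
      Metric.infDist Y S ≤ (r + 2 * η) * (1 - η)⁻¹ * Metric.infDist X S := by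
  have hpos : 0 < 1 - η := by linarith
  set a := Metric.infDist X S
  have ha : 0 ≤ a := Metric.infDist_nonneg
  have h₄ : ‖Y - X‖ ≤ (1 - η)⁻¹ * a := by
    rw [← div_eq_inv_mul, le_div_iff₀ hpos]
    linarith [norm_sub_le_norm_sub_add_norm_sub Y p X]
  refine ⟨h₄, ?_⟩
  have h₅ : Metric.infDist Y S ≤ Metric.infDist p S + dist Y p :=
    Metric.infDist_le_infDist_add_dist
  rw [dist_eq_norm] at h₅
  have h₆ : η * ‖Y - X‖ ≤ η * ((1 - η)⁻¹ * a) := mul_le_mul_of_nonneg_left h₄ hη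
  have h₇ : 0 ≤ r * a := Metric.infDist_nonneg.trans h₃
  have h₈ : r * a ≤ (1 - η)⁻¹ * (r * a) :=
    le_mul_of_one_le_left h₇ ((one_le_inv₀ hpos).2 (by linarith))
  -- The triangle inequality costs one `η`; the second in `2 η` is slack.
  have h₉ : 0 ≤ η * ((1 - η)⁻¹ * a) := by positivity
  linarith

theorem IsProx.norm_sub_self_le_infDist {H : Type*} [NormedAddCommGroup H]
    [InnerProductSpace ℝ H] {G : H → EReal} {c : ℝ} {x p : H} {γ g : ℝ}
    (hp : IsProx G c x p γ) (hc : 0 < c) {S : Set H} (hS : ∀ z, z ∈ S ↔ IsMinVal G g z)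
    (hne : S.Nonempty) : ‖p - x‖ ≤ Metric.infDist x S :=
  (Metric.le_infDist hne).2 fun z hz => by
    rw [dist_eq_norm]
    exact hp.norm_sub_self_le hc ((hS z).1 hz)

theorem norm_sub_le_of_sq_le {H : Type*} [NormedAddCommGroup H] {c η : ℝ} (hc : 0 < c)
    (hη : 0 ≤ η) {X Y p : H}
    (h : ‖Y - p‖ ^ 2 ≤ 2 * c * (η ^ 2 / (2 * c) * ‖Y - X‖ ^ 2)) : ‖Y - p‖ ≤ η * ‖Y - X‖ := by
  refine le_of_sq_le_sq ?_ (by positivity)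
  refine h.trans (le_of_eq ?_)
  field_simp

/-- Factor the difference of squares, bound `‖X‖ - ‖Y‖` by the step length, and trade one factor of
the step length for `(1 - η)⁻¹ a`. -/
theorem gap_bound_le {H : Type*} [NormedAddCommGroup H] {c η a : ℝ} {X Y : H} (hc : 0 < c) (h : ‖Y - X‖ ≤ (1 - η)⁻¹ * a) :
    η ^ 2 / (2 * c) * ‖Y - X‖ ^ 2 + 1 / (2 * c) * (‖X‖ ^ 2 - ‖Y‖ ^ 2) ≤
      c⁻¹ * (1 - η)⁻¹ * (η ^ 2 * ‖Y - X‖ + ‖Y‖ + ‖X‖) / 2 * a := by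
  have h₁ : ‖X‖ - ‖Y‖ ≤ ‖Y - X‖ := by
    rw [norm_sub_rev]
    exact norm_sub_norm_le X Y
  have h₂ : η ^ 2 / (2 * c) * ‖Y - X‖ ^ 2 + 1 / (2 * c) * (‖X‖ ^ 2 - ‖Y‖ ^ 2) =
      c⁻¹ / 2 * (η ^ 2 * ‖Y - X‖ * ‖Y - X‖ + (‖X‖ - ‖Y‖) * (‖Y‖ + ‖X‖)) := by
    field_simp
    ring
  have h₃ : (‖X‖ - ‖Y‖) * (‖Y‖ + ‖X‖) ≤ ‖Y - X‖ * (‖Y‖ + ‖X‖) :=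
    mul_le_mul_of_nonneg_right h₁ (by positivity)
  have h₄ : 0 ≤ η ^ 2 * ‖Y - X‖ + ‖Y‖ + ‖X‖ := by positivity
  have h₅ := mul_le_mul_of_nonneg_right h h₄
  have h₆ : 0 < c⁻¹ / 2 := by positivity
  rw [h₂]
  calc c⁻¹ / 2 * (η ^ 2 * ‖Y - X‖ * ‖Y - X‖ + (‖X‖ - ‖Y‖) * (‖Y‖ + ‖X‖))
      ≤ c⁻¹ / 2 * ((1 - η)⁻¹ * a * (η ^ 2 * ‖Y - X‖ + ‖Y‖ + ‖X‖)) :=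
        mul_le_mul_of_nonneg_left (by linarith) h₆.le
    _ = _ := by ring

/-! ### Combining the one-step estimates -/

namespace Problem

variable {d e : ℕ} {𝕏 : Type*} [NormedAddCommGroup 𝕏] [InnerProductSpace ℝ 𝕏]
  {P : Problem d e 𝕏} [FiniteDimensional ℝ 𝕏]

theorem Standing.isClosed_ΩP (hP : P.Standing) {g : ℝ}
    (hg : ∀ X, X ∈ P.ΩP ↔ IsMinVal P.primal g X) (hΩ : P.ΩP.Nonempty) : IsClosed P.ΩP := by
  obtain ⟨X₀, hX₀⟩ := hΩ
  have hmin := ((hg X₀).1 hX₀).2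
  have : P.ΩP = P.primal ⁻¹' Set.Iic (g : EReal) := by
    ext X
    rw [hg]
    exact ⟨fun h => h.1.le, fun h => ⟨le_antisymm h (hmin X), hmin⟩⟩
  rw [this]
  exact (hP.primal_properClosedConvex ⟨X₀, hX₀⟩).2.1.isClosed_preimage _

/-- The rates of the augmented Lagrangian method under quadratic growth. -/
theorem Standing.eventually_rates (hP : P.Standing) (hΩ : P.ΩP.Nonempty) {g : ℝ}
    (hg : ∀ X, X ∈ P.ΩP ↔ IsMinVal P.primal g X) {c : ℕ → ℝ} (hc : ∀ k, 0 < c k)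
    {Z : ℕ → DualVar d e 𝕏} {X p : ℕ → 𝕏} {γ : ℕ → ℝ}
    (hp : ∀ k, IsProx P.primal (c k) (X k) (p k) (γ k))
    (hup : ∀ k, X (k + 1) = X k + c k • P.res (Z (k + 1)))
    {x : 𝕏} (hx : x ∈ P.ΩP) (hlim : Tendsto p atTop (𝓝 x)) {κ : ℝ} (hκ : 0 < κ)
    (hgrowth : P.QuadGrowth x κ) {η : ℕ → ℝ} (hB : P.CriterionB c η Z X) :
    ∃ k₀, ∀ k ≥ k₀, η k < 1 ∧
      Metric.infDist (X (k + 1)) P.ΩP ≤ rateθ κ c η k * Metric.infDist (X k) P.ΩP ∧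
      ‖P.res (Z (k + 1))‖ ≤ rateτ₁ c η k * Metric.infDist (X k) P.ΩP ∧
      P.Ψ (Z (k + 1)) - P.Ψopt ≤
        ((rateτ₂ c η X k * Metric.infDist (X k) P.ΩP : ℝ) : EReal) := by
  obtain ⟨δ, hδ, hgr⟩ := hgrowth
  have hη0 := hB.η_summable.tendsto_atTop_zero
  refine eventually_atTop.1 ?_
  -- Growth is applied at the exact proximal points, which are feasible and eventually near `x`; the
  -- iterates `X k` need not be feasible.
  filter_upwards [hη0.eventually_lt_const zero_lt_one,
    hlim.eventually (Metric.closedBall_mem_nhds x hδ)] with k hk1 hkp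
  have hFP : p k ∈ P.FP := by
    by_contra h
    have := (hp k).1
    rw [hP.primal_of_notMem h] at this
    exact EReal.top_ne_coe _ this
  have hgk : g + κ * Metric.infDist (p k) P.ΩP ^ 2 ≤ γ k := by
    have h₁ := hgr (p k) ⟨hFP, hkp⟩
    rw [← primal_of_mem hFP, (hp k).1, ← primal_of_mem hx.1, ((hg x).1 hx).1] at h₁
    exact_mod_cast h₁
  have : ProperSpace 𝕏 := FiniteDimensional.proper ℝ 𝕏
  have hdist := (hp k).infDist_le (hc k) hg hΩ (hP.isClosed_ΩP hg hΩ) hκ hgk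
  have hsq := hP.norm_sub_prox_sq_le (hc k) (hp k) (hB.approx k)
  rw [← hup k] at hsq
  obtain ⟨hstep, hrate⟩ := step_rates (hB.η_nonneg k) hk1
    (norm_sub_le_of_sq_le (hc k) (hB.η_nonneg k) hsq)
    ((hp k).norm_sub_self_le_infDist (hc k) hg hΩ) hdist
  refine ⟨hk1, hrate, ?_, ?_⟩
  · have h₁ : c k * ‖P.res (Z (k + 1))‖ ≤ (1 - η k)⁻¹ * Metric.infDist (X k) P.ΩP := by
      have h₂ : X (k + 1) - X k = c k • P.res (Z (k + 1)) := by rw [hup k]; abel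
      rwa [h₂, norm_smul, Real.norm_eq_abs, abs_of_pos (hc k)] at hstep
    rw [rateτ₁, mul_assoc, ← div_eq_inv_mul, le_div_iff₀ (hc k)]
    linarith
  · have h₁ := hP.Ψ_sub_Ψopt_le (hc k) (hp k) (hB.approx k)
    rw [← hup k] at h₁
    refine h₁.trans ((add_le_add (hB.approx k) le_rfl).trans ?_)
    rw [← EReal.coe_add, EReal.coe_le_coe_iff]
    exact gap_bound_le (hc k) hstep

end Problem

end MatrixOpt

end

theorem theorem20 {d e : ℕ} {𝕏 : Type*} [NormedAddCommGroup 𝕏] [InnerProductSpace ℝ 𝕏]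
    [FiniteDimensional ℝ 𝕏] (P : MatrixOpt.Problem d e 𝕏) (hP : P.Standing)
    (hΩ : P.ΩP.Nonempty)
    (c : ℕ → ℝ) (hc : ∀ k, 0 < c k) (hmono : Monotone c)
    (cInf : ℝ≥0∞) (hcInf : Tendsto (fun k => ENNReal.ofReal (c k)) atTop (𝓝 cInf))
    (ε : ℕ → ℝ) (Z : ℕ → MatrixOpt.DualVar d e 𝕏) (X : ℕ → 𝕏)
    (hALM : P.IsALM c ε Z X) :
    Bornology.IsBounded (Set.range X) ∧
    ∃ XInf ∈ P.ΩP, Tendsto X atTop (𝓝 XInf) ∧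
      -- dual feasibility
      (∀ k, ‖P.res (Z (k + 1))‖ = (c k)⁻¹ * ‖X (k + 1) - X k‖) ∧
      Tendsto (fun k => (c k)⁻¹ * ‖X (k + 1) - X k‖) atTop (𝓝 0) ∧
      -- dual objective gap
      (∀ k, P.Ψ (Z (k + 1)) - P.Ψopt ≤ P.subGap (c k) (X k) (Z (k + 1)) +
        ((1 / (2 * c k) * (‖X k‖ ^ 2 - ‖X (k + 1)‖ ^ 2) : ℝ) : EReal)) ∧
      -- boundedness and accumulation points of the dual sequence
      (P.ΩD.Nonempty → Bornology.IsBounded P.ΩD →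
        Bornology.IsBounded (Set.range Z) ∧
        ∀ ZInf, MapClusterPt ZInf atTop Z → ZInf ∈ P.ΩD) ∧
      -- rates under quadratic growth and the second stopping criterion
      (∀ κ > 0, P.QuadGrowth XInf κ → ∀ η : ℕ → ℝ, P.CriterionB c η Z X →
        (∃ k₀, ∀ k ≥ k₀, η k < 1 ∧
          Metric.infDist (X (k + 1)) P.ΩP ≤
            MatrixOpt.rateθ κ c η k * Metric.infDist (X k) P.ΩP ∧
          ‖P.res (Z (k + 1))‖ ≤ MatrixOpt.rateτ₁ c η k * Metric.infDist (X k) P.ΩP ∧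
          P.Ψ (Z (k + 1)) - P.Ψopt ≤
            ((MatrixOpt.rateτ₂ c η X k * Metric.infDist (X k) P.ΩP : ℝ) : EReal)) ∧
        Tendsto (MatrixOpt.rateθ κ c η) atTop (𝓝 (MatrixOpt.rateθInf κ cInf)) ∧
        MatrixOpt.rateθInf κ cInf < 1 ∧
        Tendsto (MatrixOpt.rateτ₁ c η) atTop (𝓝 (MatrixOpt.invInf cInf)) ∧
        Tendsto (MatrixOpt.rateτ₂ c η X) atTop (𝓝 (‖XInf‖ * MatrixOpt.invInf cInf))) := by
  obtain ⟨g, hg⟩ := hP.exists_isMinVal hΩ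
  obtain ⟨z, hz⟩ := id hΩ
  have hzmin := (hg z).1 hz
  have hpcc := hP.primal_properClosedConvex hΩ
  choose p γ hp using fun k => MatrixOpt.exists_isProx hpcc hzmin (hc k) (X k)
  have hclose : ∀ k, ‖X (k + 1) - p k‖ ≤ ε k := fun k => by
    have h := hP.norm_sub_prox_sq_le (hc k) (hp k) (hALM.approx k)
    rw [← hALM.update k, mul_div_cancel₀ _ (mul_pos two_pos (hc k)).ne'] at h
    exact le_of_sq_le_sq h (hALM.ε_nonneg k)
  obtain ⟨XInf, hmin, hX, hpX⟩ := MatrixOpt.exists_tendsto_of_isProx hpcc.2.1 hzmin hc hmono hp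
    hALM.ε_nonneg hALM.ε_summable hclose
  have hXΩ : XInf ∈ P.ΩP := (hg XInf).2 hmin
  have hX' : Tendsto (fun k => X (k + 1)) atTop (𝓝 XInf) := (tendsto_add_atTop_iff_nat 1).2 hX
  have hres : ∀ k, ‖P.res (Z (k + 1))‖ = (c k)⁻¹ * ‖X (k + 1) - X k‖ := fun k => by
    rw [hALM.update k, add_sub_cancel_left, norm_smul, Real.norm_eq_abs, abs_of_pos (hc k),
      inv_mul_cancel_left₀ (hc k).ne']
  have hres0 : Tendsto (fun k => (c k)⁻¹ * ‖X (k + 1) - X k‖) atTop (𝓝 0) := by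
    simpa using (MatrixOpt.tendsto_inv_penalty hc hmono hcInf).mul (hX'.sub hX).norm
  have hgap : ∀ k, P.Ψ (Z (k + 1)) - P.Ψopt ≤ P.subGap (c k) (X k) (Z (k + 1)) +
      ((1 / (2 * c k) * (‖X k‖ ^ 2 - ‖X (k + 1)‖ ^ 2) : ℝ) : EReal) := fun k => by
    have h := hP.Ψ_sub_Ψopt_le (hc k) (hp k) (hALM.approx k)
    rwa [← hALM.update k] at h
  refine ⟨Metric.isBounded_range_of_tendsto X hX, XInf, hXΩ, hX, hres, hres0, hgap, ?_, ?_⟩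
  · intro hne hbdd
    obtain ⟨v, hv, hmem⟩ := hP.exists_mem_ΩD hne
    set δ : ℕ → ℝ := fun k => ε k ^ 2 / (2 * c k) + 1 / (2 * c k) * (‖X k‖ ^ 2 - ‖X (k + 1)‖ ^ 2)
    have hδ : Tendsto δ atTop (𝓝 0) := by
      have hinv := (MatrixOpt.tendsto_inv_penalty hc hmono hcInf).div_const 2
      have hsum := ((hALM.ε_summable.tendsto_atTop_zero.pow 2).add
        ((hX.norm.pow 2).sub (hX'.norm.pow 2)))
      have h := hinv.mul hsum
      simp only [ne_eq, OfNat.ofNat_ne_zero, not_false_eq_true, zero_pow, sub_self, add_zero,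
        mul_zero] at h
      refine h.congr fun k => ?_
      have := (hc k).ne'
      simp only [δ]
      field_simp
    have hΨ : ∀ k, P.Ψ (Z (k + 1)) ≤ ((v + δ k : ℝ) : EReal) := fun k => by
      have h := (hgap k).trans (add_le_add (hALM.approx k) le_rfl)
      rw [hv, ← EReal.coe_add, EReal.sub_le_iff_le_add (Or.inl (EReal.coe_ne_bot _))
        (Or.inl (EReal.coe_ne_top _)), ← EReal.coe_add] at h
      rwa [add_comm v]
    -- The bound on `Z (k + 1)` is indexed by `k`; the truncated value at `k = 0` is harmless, as `Z
    -- 0` is arbitrary and only eventual bounds are needed.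
    have hδ' : Tendsto (fun k => δ (k - 1)) atTop (𝓝 0) :=
      (tendsto_add_atTop_iff_nat 1).1 (by simpa using hδ)
    have hΨ' : ∀ᶠ k in atTop, P.Ψ (Z k) ≤ ((v + δ (k - 1) : ℝ) : EReal) := by
      filter_upwards [eventually_ge_atTop 1] with k hk
      obtain ⟨j, rfl⟩ := Nat.exists_eq_add_of_le' hk
      simpa using hΨ j
    have hr : Tendsto (fun k => P.res (Z k)) atTop (𝓝 0) := by
      refine (tendsto_add_atTop_iff_nat 1).1 (tendsto_zero_iff_norm_tendsto_zero.2 ?_)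
      exact hres0.congr fun k => (hres k).symm
    refine ⟨hP.isBounded_range_of_isBounded_ΩD hmem hne hbdd hδ' hΨ' hr, fun W hW => ?_⟩
    obtain ⟨φ, hφ, hlim⟩ := hW.tendsto_subseq
    exact hP.mem_ΩD_of_tendsto hmem (hδ'.comp hφ.tendsto_atTop)
      (hφ.tendsto_atTop.eventually hΨ') (hr.comp hφ.tendsto_atTop) hlim
  · intro κ hκ hgrowth η hB
    have hη := hB.η_summable.tendsto_atTop_zero
    exact ⟨hP.eventually_rates hΩ hg hc hp hALM.update hXΩ hpX hκ hgrowth hB,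
      MatrixOpt.tendsto_rateθ hc hmono hcInf hκ hη, MatrixOpt.rateθInf_lt_one hc hmono hcInf hκ,
      MatrixOpt.tendsto_rateτ₁ hc hmono hcInf hη, MatrixOpt.tendsto_rateτ₂ hc hmono hcInf hη hX⟩
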